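/- **Model.** In the MPC model, $M$ machines with local memories of $S$ words communicate in synchronous rounds. In a round every machine performs an arbitrary local computation on its memory and on the messages received in the previous round, and then sends messages to the other machines; no machine may ever store, send in one round, or receive in one round more than $S$ words. The input is an $n$-node graph whose nodes carry the unique identifiers $1,\dots,n$; its nodes and edges are distributed arbitrarily among the machines (at most $S$ words per machine, one word per node and two per edge). The algorithm may depend arbitrarily on $n$ and may use a uniformly random seed available to all machines; it *succeeds with high probability* if for every admissible input and every distribution of it, with probability at least $1-1/n$, the memory bounds are respected and the output is correct. It is a *low-space* algorithm if, for constants $0<\delta<1$ and $c$ and all sufficiently large $n$, $S=\lfloor n^\delta\rfloor$, words come from a domain of at most $n^c$ elements (i.e. have $O(\log n)$ bits), $M\le n^c$ (polynomial global memory), and $M\cdot S\ge 3n$ (inputs with at most $n$ edges can be stored). **1-vs-2-cycles conjecture.** For no $0<\delta<1$ is there a low-space MPC algorithm that, for all sufficiently large $n$, decides with high probability in $o(\log n)$ rounds whether the input graph, promised to be either one cycle of $n$ nodes or two disjoint cycles of $n/2$ nodes each, is one cycle (the answer being output by a designated machine). **Connected components.** The machine initially holding a node $v$ has to output the maximum identifier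 in the connected component of $v$. For a forest, let $D$ denote the maximum diameter of its connected components. **Corollary.** Assume the 1-vs-2-cycles conjecture. Then for no $0<\delta<1$ is there a low-space MPC algorithm (deterministic or randomized, even if it is given $D$) that, for all sufficiently large $n$ and all $D$, solves connected components with high probability on all $n$-node forests with maximum component diameter $D$ in $T(n,D)=o(\log D)$ rounds. Here $T(n,D)=o(\log D)$ means that $T(n,D(n))=o(\log D(n))$ as $n\to\infty$ for every function $D(n)$ with $D(n)\in\Omega(\log n)$ and $D(n)=n^{o(1)}$; in particular, every bound $T(n,D)\le f(D)$ with $f(D)=o(\log D)$ as $D\to\infty$ is excluded. -/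

import Mathlib

open Filter Asymptotics

namespace MPC

/-- The distribution of an input graph with node set `Fin n` (a node is identified with its unique
identifier) among `M` machines: every node and every edge is stored at one machine. The values of
`edge` at pairs that are not edges of the graph at hand play no role. -/
structure Placement (n M : ℕ) where
  node : Fin n → Fin M
  edge : Sym2 (Fin n) → Fin M

namespace Placement

variable {n M : ℕ}

/-- The nodes that machine `i` holds initially. -/
def nodesAt (p : Placement n M) (i : Fin M) : Finset (Fin n) :=
  Finset.univ.filter fun v => p.node v = i

open Classical in
/-- The edges of `G` that machine `i` holds initially. -/
noncomputable def edgesAt (p : Placement n M) (G : SimpleGraph (Fin n)) (i : Fin M) :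
    Finset (Sym2 (Fin n)) :=
  Finset.univ.filter fun e => e ∈ G.edgeSet ∧ p.edge e = i

/-- Initially no machine holds more than `S` words: a node takes one word (its identifier), an edge
takes two words (the identifiers of its endpoints). -/
def Fits (p : Placement n M) (G : SimpleGraph (Fin n)) (S : ℕ) : Prop :=
  ∀ i, (p.nodesAt i).card + 2 * (p.edgesAt G i).card ≤ S

end Placement

/-- The situation between two rounds on `M` machines with words from a domain of `W` elements:
the local memory of each machine, and the messages that have just been delivered;
`inbox j i` is the message that machine `j` has received from machine `i`. -/
structure Config (M W : ℕ) where
  state : Fin M → List (Fin W)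
  inbox : Fin M → Fin M → List (Fin W)

/-- No machine stores, has received, or has sent more than `S` words. -/
def Config.WithinMemory {M W : ℕ} (C : Config M W) (S : ℕ) : Prop :=
  ∀ i, (C.state i).length ≤ S ∧
    ∑ j, (C.inbox i j).length ≤ S ∧
    ∑ j, (C.inbox j i).length ≤ S

/-- A (randomized) MPC protocol for input graphs with `n` nodes in which every machine produces an
output of type `Out`. Local computations are arbitrary functions; they may use a uniformly random
seed. A deterministic protocol is one with a single seed. -/
structure Protocol (n : ℕ) (Out : Type) where
  /-- number of machines -/
  machines : ℕ
  /-- size of the domain of words -/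
  words : ℕ
  /-- the random seeds -/
  Seed : Type
  [seedFintype : Fintype Seed]
  [seedNonempty : Nonempty Seed]
  /-- the initial content of the local memory of a machine, computed from the nodes and edges that
  the machine holds -/
  init : Seed → Fin machines → Finset (Fin n) → Finset (Sym2 (Fin n)) → List (Fin words)
  /-- the local computation of a machine in a given round: from its local memory and the messages
  it has received it computes its new local memory and the messages it sends to the machines -/
  step : Seed → ℕ → Fin machines → List (Fin words) → (Fin machines → List (Fin words)) →
    List (Fin words) × (Fin machines → List (Fin words))
  /-- the output of a machine, computed from its final local memory and the messages it has
  received last -/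
  output : Seed → Fin machines → List (Fin words) → (Fin machines → List (Fin words)) → Out

attribute [instance] Protocol.seedFintype Protocol.seedNonempty

namespace Protocol

variable {n : ℕ} {Out : Type}

/-- The configuration after `t` rounds on the input `G` distributed by `p`. -/
noncomputable def config (P : Protocol n Out) (G : SimpleGraph (Fin n))
    (p : Placement n P.machines) (s : P.Seed) : ℕ → Config P.machines P.words
  | 0 =>
    { state := fun i => P.init s i (p.nodesAt i) (p.edgesAt G i)
      inbox := fun _ _ => [] }
  | t + 1 =>
    { state := fun i =>
        (P.step s t i ((P.config G p s t).state i) ((P.config G p s t).inbox i)).1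
      inbox := fun j i =>
        (P.step s t i ((P.config G p s t).state i) ((P.config G p s t).inbox i)).2 j }

/-- The outputs of the machines after `T` rounds. -/
noncomputable def result (P : Protocol n Out) (G : SimpleGraph (Fin n))
    (p : Placement n P.machines) (s : P.Seed) (T : ℕ) : Fin P.machines → Out :=
  fun i => P.output s i ((P.config G p s T).state i) ((P.config G p s T).inbox i)

open Classical in
/-- The probability, over the uniformly random seed, that during `T` rounds no machine exceeds its
local memory of `S` words and the outputs after these rounds satisfy `good`. -/
noncomputable def successProb (P : Protocol n Out) (G : SimpleGraph (Fin n))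
    (p : Placement n P.machines) (S T : ℕ) (good : (Fin P.machines → Out) → Prop) : ℝ :=
  ((Finset.univ.filter fun s : P.Seed =>
      (∀ t ≤ T, (P.config G p s t).WithinMemory S) ∧ good (P.result G p s T)).card : ℝ) /
    (Fintype.card P.Seed : ℝ)

end Protocol

/-- The local memory of a machine in the low-space regime: `n ^ δ` words. -/
noncomputable def localMemory (δ : ℝ) (n : ℕ) : ℕ := ⌊(n : ℝ) ^ δ⌋₊

/-- The global resources of a low-space protocol: at most `n ^ c` machines, words of at most
`c * log n` bits, and enough memory in total to store every input with `n` nodes and at most `n`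
edges, which takes up to `3 * n` words. -/
def Protocol.LowSpace {n : ℕ} {Out : Type} (P : Protocol n Out) (δ : ℝ) (c : ℕ) : Prop :=
  P.machines ≤ n ^ c ∧ P.words ≤ n ^ c ∧ 3 * n ≤ P.machines * localMemory δ n

/-- `G` is a cycle through all of its `n` nodes. -/
def IsOneCycle {n : ℕ} (G : SimpleGraph (Fin n)) : Prop :=
  3 ≤ n ∧ Nonempty (G ≃g SimpleGraph.cycleGraph n)

/-- `G` consists of two disjoint cycles with `n / 2` nodes each. -/
def IsTwoCycles {n : ℕ} (G : SimpleGraph (Fin n)) : Prop :=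
  ∃ k, 3 ≤ k ∧ n = 2 * k ∧
    Nonempty (G ≃g (SimpleGraph.cycleGraph k ⊕g SimpleGraph.cycleGraph k))

/-- In `T` rounds and with local memory `S`, the protocol tells one cycle from two cycles with high
probability, however the input is distributed; the answer is the output of machine `0`. -/
def Protocol.SolvesOneVsTwoCycles {n : ℕ} (P : Protocol n Bool) (S T : ℕ) : Prop :=
  ∀ (G : SimpleGraph (Fin n)) (p : Placement n P.machines), p.Fits G S →
    (IsOneCycle G →
      1 - 1 / (n : ℝ) ≤ P.successProb G p S T fun out => ∀ i, i.val = 0 → out i = true) ∧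
    (IsTwoCycles G →
      1 - 1 / (n : ℝ) ≤ P.successProb G p S T fun out => ∀ i, i.val = 0 → out i = false)

/-- The 1-vs-2-cycles conjecture: for no constant `0 < δ < 1` does a low-space MPC algorithm
with polynomial global memory tell one cycle of `n` nodes from two cycles of `n / 2` nodes in
`o(log n)` rounds. -/
def OneVsTwoCyclesConjecture : Prop :=
  ∀ δ : ℝ, 0 < δ → δ < 1 →
    ¬ ∃ (A : ∀ n : ℕ, Protocol n Bool) (c : ℕ) (T : ℕ → ℕ),
      (fun n => (T n : ℝ)) =o[atTop] (fun n : ℕ => Real.log n) ∧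
      ∀ᶠ n : ℕ in atTop,
        (A n).LowSpace δ c ∧ (A n).SolvesOneVsTwoCycles (localMemory δ n) (T n)

/-- The maximum diameter of a connected component of `G`. Pairs of nodes in different components
contribute nothing, as `SimpleGraph.dist` is `0` there. -/
noncomputable def maxComponentDiam {n : ℕ} (G : SimpleGraph (Fin n)) : ℕ :=
  Finset.univ.sup fun q : Fin n × Fin n => G.dist q.1 q.2

/-- In `T` rounds and with local memory `S`, the protocol solves connected components with high
probability on every forest with `n` nodes and maximum component diameter `D`, however the input is
distributed: the machine that holds the node `v` knows the maximum identifier in the component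
of `v`. -/
def Protocol.SolvesCCOnForests {n : ℕ} (P : Protocol n (Fin n → Fin n)) (D S T : ℕ) : Prop :=
  ∀ (G : SimpleGraph (Fin n)) (p : Placement n P.machines),
    G.IsAcyclic → maxComponentDiam G = D → p.Fits G S →
      1 - 1 / (n : ℝ) ≤ P.successProb G p S T
        fun out => ∀ v, IsGreatest {u | G.Reachable v u} (out (p.node v) v)

/-- `D` lies in `Ω(log n)` and in `n ^ o(1)`. -/
def AdmissibleDiameter (D : ℕ → ℕ) : Prop :=
  (fun n : ℕ => Real.log n) =O[atTop] (fun n => (D n : ℝ)) ∧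
    (fun n => Real.log (D n)) =o[atTop] (fun n : ℕ => Real.log n)

/-- The number of rounds `T n D` is `o(log D)`: along all diameters `D = D(n)` in `Ω(log n)` and
`n ^ o(1)`. This is implied by `T n D ≤ f D` for some `f` in `o(log D)`. -/
def IsLittleOLogDiam (T : ℕ → ℕ → ℕ) : Prop :=
  ∀ D : ℕ → ℕ, AdmissibleDiameter D →
    (fun n => (T n (D n) : ℝ)) =o[atTop] (fun n => Real.log (D n))

end MPC

/-!
If connected components of forests could be computed in `o(log D)` rounds, then one cycle could be
told from two in `o(log n)` rounds, by repeated random contraction.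

Let `G` be one cycle or two cycles on `n` nodes. Give every node a uniformly random rank from the
shared seed, and let `V 0 ⊇ V 1 ⊇ ⋯ ⊇ V K` be the nodes of rank below decreasing thresholds, so that
`V k` has density `B ^ (-k)`. Let `level G V k` be the graph obtained from `G` by contracting
everything outside of `V k`; it joins the members of `V k` that are consecutive along a cycle
(`EvenlySpread.consecutive_level`). Removing `V (k + 1)` from it leaves a forest of short paths. Its
components tell each member of `V (k + 1)` the next one, that is, they yield `level G V (k + 1)`,
and contraction preserves connectivity (`contract_reachable_iff`). As `V K` is small, one machine
can finally inspect `level G V K`.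

With high probability the samples are evenly spread (`card_not_evenlySpread_le`): by a union bound
over the windows along the cycles and the levels, no window of `L * B ^ (k + 1)` consecutive nodes
misses `V (k + 1)`, and none contains more than `D = 4 * L * B` members of `V k`. Both estimates
follow from the generating function of the number of sampled nodes (`sum_pow_card_sample`). Hence
every component of the forests has at most `D + 1` nodes.

The given protocol for connected components is applied to these forests, padded by a path of length
`D`, so that the maximum component diameter is exactly `D`, and by isolated nodes up to
`N = O(n log n)` nodes. The padding makes the failure probability `1 / N` small enough for a union
bound over the `K` phases, and it leaves room for dealing out the input evenly (`dealt_fits`). The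
forests depend only on the ranks, so the same independent seed serves the simulated protocol in all
phases. A phase takes `T + 5` rounds: edges are handed to the simulated machines, the simulation
runs, every node learns its label, the nodes next to `V (k + 1)` report to the node named by the
label, and this node introduces the reported members of `V (k + 1)` to each other (`run_phase`).

With `B = Θ(log n)` and `L = 4 * B` we have `D = Θ((log n) ^ 2)`, so that `log D = O(log B)`. There
are at most `log n / log B` phases of `o(log D)` rounds each, `o(log n)` rounds in total
(`isLittleO_rounds`). The local memory `n ^ ((1 + δ) / 2)` exceeds both `N ^ δ` and every
polynomial in `log n`.
-/


namespace MPC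

/-! ### Contraction, padding, and a criterion for acyclicity -/

section Graphs

variable {V : Type*}

/-- The graph that `H` induces outside of `U`, on the vertex set of `H`: the members of `U` are
isolated. -/
def outside (H : SimpleGraph V) (U : Finset V) : SimpleGraph V where
  Adj u v := H.Adj u v ∧ u ∉ U ∧ v ∉ U
  symm := ⟨fun _ _ h => ⟨h.1.symm, h.2.2, h.2.1⟩⟩
  loopless := ⟨fun _ h => h.1.ne rfl⟩

/-- The graph on `U` obtained from `H` by contracting every component of `outside H U` to an edge
between any two members of `U` adjacent to it. -/
def contract (H : SimpleGraph V) (U : Finset V) : SimpleGraph V where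
  Adj x y := x ≠ y ∧ x ∈ U ∧ y ∈ U ∧ (H.Adj x y ∨ ∃ u w, H.Adj u x ∧ H.Adj w y ∧ u ∉ U ∧ w ∉ U ∧
    (outside H U).Reachable u w)
  symm := ⟨by
    rintro x y ⟨h, hx, hy, hxy⟩
    refine ⟨h.symm, hy, hx, hxy.imp SimpleGraph.Adj.symm ?_⟩
    rintro ⟨u, w, hu, hw, hu', hw', hr⟩
    exact ⟨w, u, hw, hu, hw', hu', hr.symm⟩⟩
  loopless := ⟨fun _ h => h.1 rfl⟩

/-- Induction along walks. -/
theorem reachable_induction {G : SimpleGraph V} {P : V → Prop} (hP : ∀ u v, G.Adj u v → P u → P v)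
    {u v : V} (h : G.Reachable u v) (hu : P u) : P v := by
  obtain ⟨p⟩ := h
  induction p with
  | nil => exact hu
  | cons hadj _ ih => exact ih (hP _ _ hadj hu)

theorem reachable_of_contract_adj {H : SimpleGraph V} {U : Finset V} {x y : V}
    (h : (contract H U).Adj x y) : H.Reachable x y := by
  obtain ⟨-, -, -, h | ⟨u, w, hu, hw, -, -, hr⟩⟩ := h
  · exact h.reachable
  · refine hu.symm.reachable.trans (.trans ?_ hw.reachable)
    exact hr.mono (show outside H U ≤ H from fun a b hab => hab.1)

/-- Contraction preserves reachability between the remaining vertices. -/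
theorem contract_reachable_iff {H : SimpleGraph V} {U : Finset V} {x y : V} (hx : x ∈ U)
    (hy : y ∈ U) : (contract H U).Reachable x y ↔ H.Reachable x y := by
  constructor
  · intro h
    exact reachable_induction (P := fun z => H.Reachable x z)
      (fun u v huv hu => hu.trans (reachable_of_contract_adj huv)) h (.refl _)
  · intro h
    -- Along a walk from `x`, a vertex outside of `U` lies in a component that is adjacent to some
    -- member of `U` reached before.
    have key : ∀ z, H.Reachable x z → (z ∈ U → (contract H U).Reachable x z) ∧
        (z ∉ U → ∃ x' ∈ U, (contract H U).Reachable x x' ∧ ∃ u, H.Adj u x' ∧ u ∉ U ∧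
          (outside H U).Reachable u z) := by
      intro z hz
      refine reachable_induction (P := fun z => (z ∈ U → (contract H U).Reachable x z) ∧
        (z ∉ U → ∃ x' ∈ U, (contract H U).Reachable x x' ∧ ∃ u, H.Adj u x' ∧ u ∉ U ∧
          (outside H U).Reachable u z)) ?_ hz ⟨fun _ => .refl _, fun h => absurd hx h⟩
      rintro a b hab ⟨h1, h2⟩
      by_cases ha : a ∈ U
      · refine ⟨fun hb => (h1 ha).trans (SimpleGraph.Adj.reachable ⟨hab.ne, ha, hb, .inl hab⟩),
          fun hb => ⟨a, ha, h1 ha, b, hab.symm, hb, .refl _⟩⟩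
      · obtain ⟨x', hx', hr, u, hu, hu', hua⟩ := h2 ha
        refine ⟨fun hb => ?_, fun hb => ⟨x', hx', hr, u, hu, hu',
          hua.trans (SimpleGraph.Adj.reachable ⟨hab, ha, hb⟩)⟩⟩
        by_cases hxb : x' = b
        · exact hxb ▸ hr
        · exact hr.trans (SimpleGraph.Adj.reachable
            ⟨hxb, hx', hb, .inr ⟨u, a, hu, hab, hu', ha, hua⟩⟩)
    exact (key y h).1 hy

/-- A graph is acyclic if its vertices can be ranked such that no two adjacent vertices have the
same rank and every vertex has at most one neighbor of smaller rank: on a cycle, both neighbors of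
a vertex of maximum rank would have smaller rank. -/
theorem isAcyclic_of_rank {G : SimpleGraph V} (f : V → ℕ) (hne : ∀ u v, G.Adj u v → f u ≠ f v)
    (huniq : ∀ u v w, G.Adj u v → G.Adj u w → f v < f u → f w < f u → v = w) : G.IsAcyclic := by
  classical
  intro v c hc
  obtain ⟨u, hu, hmax⟩ := c.support.toFinset.exists_max_image f ⟨v, by simp⟩
  rw [List.mem_toFinset] at hu
  have h2 := hc.ncard_neighborSet_toSubgraph_eq_two hu
  rw [Set.ncard_eq_two] at h2
  obtain ⟨a, b, hab, hset⟩ := h2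
  have key : ∀ w, w ∈ c.toSubgraph.neighborSet u → G.Adj u w ∧ f w < f u := by
    intro w hw
    have hadj : c.toSubgraph.Adj u w := hw
    have hG := hadj.adj_sub
    have hwm : w ∈ c.support := c.mem_verts_toSubgraph.mp (c.toSubgraph.edge_vert hadj.symm)
    exact ⟨hG, lt_of_le_of_ne (hmax w (by simpa using hwm)) (hne _ _ hG.symm)⟩
  have ha := key a (by rw [hset]; simp)
  have hb := key b (by rw [hset]; simp)
  exact hab (huniq u a b ha.1 hb.1 ha.2 hb.2)

/-- The distance between two vertices is less than the number of vertices of the component. -/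
theorem dist_lt_of_reachable_subset {G : SimpleGraph V} {u : V} (s : Finset V)
    (hs : ∀ w, G.Reachable u w → w ∈ s) (v : V) : G.dist u v < s.card := by
  classical
  by_cases h : G.Reachable u v
  · obtain ⟨p, hp, hlen⟩ := h.exists_path_of_dist
    rw [← hlen]
    have : p.support.toFinset ⊆ s := by
      intro w hw
      rw [List.mem_toFinset] at hw
      exact hs w (p.takeUntil w hw).reachable
    have h1 := Finset.card_le_card this
    rw [List.toFinset_card_of_nodup hp.support_nodup, SimpleGraph.Walk.length_support] at h1
    omega
  · rw [SimpleGraph.dist_eq_zero_of_not_reachable h]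
    exact Finset.card_pos.2 ⟨u, hs u (.refl _)⟩

end Graphs

section Pad

variable {n N D : ℕ}

/-- The graph `F` on the first `n` of `N` nodes, together with a path of length `D` on the nodes
from `n` to `n + D`; all other nodes are isolated. -/
def pad (F : SimpleGraph (Fin n)) (N D : ℕ) : SimpleGraph (Fin N) where
  Adj a b := (∃ u v, F.Adj u v ∧ a.val = u.val ∧ b.val = v.val) ∨
    (n ≤ a.val ∧ n ≤ b.val ∧ a.val ≤ n + D ∧ b.val ≤ n + D ∧
      (a.val + 1 = b.val ∨ b.val + 1 = a.val))
  symm := ⟨by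
    rintro a b (⟨u, v, h, h1, h2⟩ | ⟨h1, h2, h3, h4, h5⟩)
    · exact .inl ⟨v, u, h.symm, h2, h1⟩
    · exact .inr ⟨h2, h1, h4, h3, h5.symm⟩⟩
  loopless := ⟨by
    rintro a (⟨u, v, h, h1, h2⟩ | ⟨h1, h2, h3, h4, h5⟩)
    · exact h.ne (Fin.ext (h1 ▸ h2))
    · omega⟩

theorem pad_adj_castLE {F : SimpleGraph (Fin n)} (hN : n ≤ N) {u v : Fin n} :
    (pad F N D).Adj (u.castLE hN) (v.castLE hN) ↔ F.Adj u v := by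
  constructor
  · rintro (⟨u', v', h, h1, h2⟩ | ⟨h1, h2, h3, h4, h5⟩)
    · rwa [show u = u' from Fin.ext h1, show v = v' from Fin.ext h2]
    · simp at h1; omega
  · exact fun h => .inl ⟨u, v, h, rfl, rfl⟩

theorem pad_reachable_castLE {F : SimpleGraph (Fin n)} (hN : n ≤ N) {u : Fin n} {b : Fin N} :
    (pad F N D).Reachable (u.castLE hN) b ↔ ∃ v, b = v.castLE hN ∧ F.Reachable u v := by
  constructor
  · intro h
    refine reachable_induction (P := fun b => ∃ v, b = v.castLE hN ∧ F.Reachable u v) ?_ h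
      ⟨u, rfl, .refl _⟩
    rintro a b hab ⟨v, rfl, hv⟩
    rcases hab with ⟨u', v', h, h1, h2⟩ | ⟨h1, h2, h3, h4, h5⟩
    · refine ⟨v', Fin.ext h2, hv.trans ?_⟩
      rw [show v = u' from Fin.ext h1]
      exact h.reachable
    · simp at h1; omega
  · rintro ⟨v, rfl, h⟩
    exact reachable_induction (P := fun v => (pad F N D).Reachable (u.castLE hN) (v.castLE hN))
      (fun a b hab ha => ha.trans ((pad_adj_castLE hN).2 hab).reachable) h (.refl _)

theorem pad_isAcyclic {F : SimpleGraph (Fin n)} (f : Fin n → ℕ)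
    (hne : ∀ u v, F.Adj u v → f u ≠ f v)
    (huniq : ∀ u v w, F.Adj u v → F.Adj u w → f v < f u → f w < f u → v = w) :
    (pad F N D).IsAcyclic := by
  let g : Fin N → ℕ := fun a => if h : a.val < n then f ⟨a, h⟩ else a.val
  have hg : ∀ (a : Fin N) (u : Fin n), a.val = u.val → g a = f u := by
    intro a u h
    have : a.val < n := h ▸ u.2
    simp only [g, this, dif_pos]
    congr 1
    exact Fin.ext h
  have hg' : ∀ a : Fin N, n ≤ a.val → g a = a.val := by
    intro a h
    simp [g, Nat.not_lt.2 h]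
  refine isAcyclic_of_rank g ?_ ?_
  · rintro a b (⟨u, v, h, h1, h2⟩ | ⟨h1, h2, h3, h4, h5⟩)
    · rw [hg a u h1, hg b v h2]
      exact hne u v h
    · rw [hg' a h1, hg' b h2]
      omega
  · rintro a b c (⟨u, v, h, h1, h2⟩ | ⟨h1, h2, h3, h4, h5⟩)
      (⟨u', v', h', h1', h2'⟩ | ⟨h1', h2', h3', h4', h5'⟩)
    · obtain rfl : u = u' := Fin.ext (h1 ▸ h1')
      rw [hg a u h1, hg b v h2, hg c v' h2']
      intro hv hv'
      exact Fin.ext (by rw [h2, h2', huniq u v v' h h' hv hv'])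
    · have := u.2; omega
    · have := u'.2; omega
    · rw [hg' a h1, hg' b h2, hg' c h2']
      intro hv hv'
      exact Fin.ext (by omega)

/-- If the components of `F` have at most `D` nodes then the padding path is a component of maximum
diameter. -/
theorem maxComponentDiam_pad {F : SimpleGraph (Fin n)} (hN : n + D < N)
    (s : Fin n → Finset (Fin n)) (hs : ∀ u v, F.Reachable u v → v ∈ s u)
    (hcard : ∀ u, (s u).card ≤ D + 1) : maxComponentDiam (pad F N D) = D := by
  have hnN : n ≤ N := by omega
  apply le_antisymm
  · apply Finset.sup_le
    rintro ⟨a, b⟩ -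
    apply Nat.le_of_lt_succ
    by_cases ha : a.val < n
    · obtain ⟨u, rfl⟩ : ∃ u : Fin n, a = u.castLE hnN := ⟨⟨a, ha⟩, rfl⟩
      refine (dist_lt_of_reachable_subset ((s u).map (Fin.castLEEmb hnN)) ?_ b).trans_le ?_
      · intro w hw
        obtain ⟨v, rfl, hv⟩ := (pad_reachable_castLE hnN).1 hw
        exact Finset.mem_map.2 ⟨v, hs u v hv, rfl⟩
      · simpa using hcard u
    · by_cases haD : a.val ≤ n + D
      · refine (dist_lt_of_reachable_subset
          (Finset.Icc (⟨n, by omega⟩ : Fin N) ⟨n + D, hN⟩) ?_ b).trans_le ?_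
        · intro w hw
          refine reachable_induction (P := fun w => w ∈ Finset.Icc (⟨n, by omega⟩ : Fin N)
            ⟨n + D, hN⟩) ?_ hw ?_
          · rintro c d (⟨u, v, h, h1, h2⟩ | ⟨h1, h2, h3, h4, h5⟩) hc
            · have := u.2
              simp only [Finset.mem_Icc, Fin.le_def] at hc
              omega
            · simp only [Finset.mem_Icc, Fin.le_def]
              omega
          · simp only [Finset.mem_Icc, Fin.le_def]
            omega
        · simp; omega
      · refine (dist_lt_of_reachable_subset {a} ?_ b).trans_le (by simp)
        intro w hw
        refine reachable_induction (P := fun w => w ∈ ({a} : Finset (Fin N))) ?_ hw (by simp)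
        rintro c d (⟨u, v, h, h1, h2⟩ | ⟨h1, h2, h3, h4, h5⟩) hc
        · have := u.2
          rw [Finset.mem_singleton] at hc
          subst hc
          omega
        · rw [Finset.mem_singleton] at hc
          subst hc
          omega
  · -- Along every edge the number of padding nodes below a node changes by at most one.
    have hwalk : ∀ {a b : Fin N} (p : (pad F N D).Walk a b),
        b.val - n ≤ a.val - n + p.length := by
      intro a b p
      induction p with
      | nil => simp
      | cons h p ih =>
        rw [SimpleGraph.Walk.length_cons]
        rcases h with ⟨u, v, h, h1, h2⟩ | ⟨h1, h2, h3, h4, h5⟩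
        · have := v.2
          omega
        · omega
    have hreach : ∀ i (hi : i ≤ D), (pad F N D).Reachable ⟨n, by omega⟩ ⟨n + i, by omega⟩ := by
      intro i
      induction i with
      | zero => exact fun _ => .refl _
      | succ i ih =>
        intro hi
        refine (ih (by omega)).trans (SimpleGraph.Adj.reachable (.inr ?_))
        simp only
        omega
    obtain ⟨p, hp⟩ := (hreach D le_rfl).exists_walk_length_eq_dist
    have := hwalk p
    simp only [Nat.add_sub_cancel_left, Nat.sub_self, hp] at this
    have hsup := Finset.le_sup (f := fun q : Fin N × Fin N => (pad F N D).dist q.1 q.2)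
      (Finset.mem_univ ((⟨n, by omega⟩ : Fin N), (⟨n + D, hN⟩ : Fin N)))
    have : (D : ℕ) ≤ (pad F N D).dist ⟨n, by omega⟩ ⟨n + D, hN⟩ := by omega
    exact this.trans hsup

end Pad

/-! ### First hits along a permutation -/

section Hits

variable {α : Type*}

/-- The number of steps from `u` to the first element of `U` at or after `u`, in the order in which
`σ` runs through its cycles (`0` if there is none). -/
noncomputable def hitTime (σ : Equiv.Perm α) (U : Finset α) (u : α) : ℕ :=
  sInf {j | (σ ^ j) u ∈ U}

/-- The first element of `U` at or after `u`. -/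
noncomputable def hit (σ : Equiv.Perm α) (U : Finset α) (u : α) : α := (σ ^ hitTime σ U u) u

/-- `U` meets every cycle of `σ`. -/
def MeetsCycles (σ : Equiv.Perm α) (U : Finset α) : Prop := ∀ u, ∃ j, (σ ^ j) u ∈ U

variable {σ : Equiv.Perm α} {U U' : Finset α}

theorem hitTime_of_mem {u : α} (h : u ∈ U) : hitTime σ U u = 0 :=
  Nat.sInf_eq_zero.2 (.inl (by simpa using h))

theorem hit_of_mem {u : α} (h : u ∈ U) : hit σ U u = u := by
  simp [hit, hitTime_of_mem h]

theorem hitTime_lt {u : α} {m : ℕ} (h : ∃ j < m, (σ ^ j) u ∈ U) : hitTime σ U u < m := by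
  obtain ⟨j, hj, hu⟩ := h
  exact (Nat.sInf_le (s := {j | (σ ^ j) u ∈ U}) hu).trans_lt hj

theorem hitTime_of_notMem (hU : MeetsCycles σ U) {u : α} (h : u ∉ U) :
    hitTime σ U u = hitTime σ U (σ u) + 1 := by
  have h0 : 0 ∉ {j | (σ ^ j) u ∈ U} := by simpa using h
  have hne : {j | (σ ^ j) u ∈ U}.Nonempty := hU u
  have h1 : 1 ≤ hitTime σ U u := by
    by_contra hlt
    have := Nat.sInf_mem hne
    rw [show sInf {j | (σ ^ j) u ∈ U} = 0 from by unfold hitTime at hlt; omega] at this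
    exact h0 this
  apply le_antisymm
  · refine Nat.sInf_le (s := {j | (σ ^ j) u ∈ U}) ?_
    have := Nat.sInf_mem (s := {j | (σ ^ j) (σ u) ∈ U}) (hU (σ u))
    rw [Set.mem_ofPred_eq, pow_succ]
    exact this
  · have hm := Nat.sInf_mem hne
    obtain ⟨j, hj⟩ := Nat.exists_eq_add_of_le' h1
    rw [hj]
    refine Nat.succ_le_succ (Nat.sInf_le (s := {j | (σ ^ j) (σ u) ∈ U}) ?_)
    have : (σ ^ (j + 1)) u ∈ U := hj ▸ hm
    rw [pow_succ] at this
    exact this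

theorem hit_of_notMem (hU : MeetsCycles σ U) {u : α} (h : u ∉ U) :
    hit σ U u = hit σ U (σ u) := by
  rw [hit, hitTime_of_notMem hU h, pow_succ]
  rfl

/-- Induction backwards from `U`. -/
theorem MeetsCycles.induction (hU : MeetsCycles σ U) {P : α → Prop} (h0 : ∀ u ∈ U, P u)
    (h1 : ∀ u, u ∉ U → P (σ u) → P u) (u : α) : P u := by
  induction h : hitTime σ U u generalizing u with
  | zero =>
    by_cases hu : u ∈ U
    · exact h0 u hu
    · rw [hitTime_of_notMem hU hu] at h
      omega
  | succ j ih =>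
    by_cases hu : u ∈ U
    · exact h0 u hu
    · rw [hitTime_of_notMem hU hu] at h
      exact h1 u hu (ih _ (by omega))

theorem MeetsCycles.mono (hU : MeetsCycles σ U') (h : U' ⊆ U) : MeetsCycles σ U := fun u =>
  (hU u).imp fun _ hj => h hj

theorem MeetsCycles.symm [Finite α] (hU : MeetsCycles σ U) : MeetsCycles σ⁻¹ U := by
  intro u
  obtain ⟨j, hj⟩ := hU u
  obtain ⟨m, hm, h1⟩ := (isOfFinOrder_of_finite σ).exists_pow_eq_one
  refine ⟨j * m - j, ?_⟩
  have : (σ⁻¹ ^ (j * m - j)) = σ ^ j := by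
    rw [inv_pow, inv_eq_iff_mul_eq_one, ← pow_add,
      Nat.sub_add_cancel (Nat.le_mul_of_pos_right j hm),
      mul_comm, pow_mul, h1, one_pow]
  rwa [this]

theorem hit_hit (hU : MeetsCycles σ U) (hU' : MeetsCycles σ U') (h : U' ⊆ U) (u : α) :
    hit σ U' (hit σ U u) = hit σ U' u := by
  refine hU.induction (P := fun u => hit σ U' (hit σ U u) = hit σ U' u) ?_ ?_ u
  · intro u hu
    rw [hit_of_mem hu]
  · intro u hu ih
    rw [hit_of_notMem hU hu, ih, ← hit_of_notMem hU' fun hu' => hu (h hu')]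

theorem hitTime_hit_le (hU : MeetsCycles σ U) (hU' : MeetsCycles σ U') (h : U' ⊆ U) (u : α) :
    hitTime σ U' (hit σ U u) ≤ hitTime σ U' u := by
  refine hU.induction (P := fun u => hitTime σ U' (hit σ U u) ≤ hitTime σ U' u) ?_ ?_ u
  · intro u hu
    rw [hit_of_mem hu]
  · intro u hu ih
    rw [hit_of_notMem hU hu, hitTime_of_notMem hU' fun hu' => hu (h hu')]
    omega

/-- The last element of `U` before the first one at or after `u` is the last one before `u`. -/
theorem hit_inv_hit [Finite α] (hU : MeetsCycles σ U) (u : α) :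
    hit σ⁻¹ U (σ⁻¹ (hit σ U u)) = hit σ⁻¹ U (σ⁻¹ u) := by
  refine hU.induction (P := fun u => hit σ⁻¹ U (σ⁻¹ (hit σ U u)) = hit σ⁻¹ U (σ⁻¹ u)) ?_ ?_ u
  · intro u hu
    rw [hit_of_mem hu]
  · intro u hu ih
    rw [hit_of_notMem hU hu, ih, show σ⁻¹ (σ u) = u by simp, hit_of_notMem hU.symm hu]

theorem eq_hit_inv [Finite α] (hU : MeetsCycles σ U) {u v : α} (hu : u ∈ U)
    (h : v = hit σ U (σ u)) : u = hit σ⁻¹ U (σ⁻¹ v) := by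
  rw [h, hit_inv_hit hU, show σ⁻¹ (σ u) = u by simp, hit_of_mem hu]

end Hits

/-! ### Graphs whose edges join consecutive elements along a permutation -/

section Cyclic

variable {α : Type*} {σ : Equiv.Perm α} {U U' : Finset α} {H : SimpleGraph α}

/-- Every edge of `H` joins two elements of `U` that are consecutive along `σ`. -/
def Consecutive (σ : Equiv.Perm α) (U : Finset α) (H : SimpleGraph α) : Prop :=
  ∀ x y, H.Adj x y → x ∈ U ∧ y ∈ U ∧ (y = hit σ U (σ x) ∨ x = hit σ U (σ y))

theorem Consecutive.hit_eq_of_adj (hH : Consecutive σ U H) (hU : MeetsCycles σ U)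
    (hU' : MeetsCycles σ U') (h : U' ⊆ U) {u v : α} (huv : (outside H U').Adj u v) :
    hit σ U' u = hit σ U' v := by
  obtain ⟨hadj, hu, hv⟩ := huv
  rcases (hH u v hadj).2.2 with e | e
  · rw [e, hit_hit hU hU' h, hit_of_notMem hU' hu]
  · rw [e, hit_hit hU hU' h, hit_of_notMem hU' hv]

/-- All nodes of a component of `outside H U'` are followed by the same element of `U'`. -/
theorem Consecutive.hit_eq_of_reachable (hH : Consecutive σ U H) (hU : MeetsCycles σ U)
    (hU' : MeetsCycles σ U') (h : U' ⊆ U) {u v : α} (huv : (outside H U').Reachable u v) :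
    hit σ U' u = hit σ U' v :=
  reachable_induction (P := fun v => hit σ U' u = hit σ U' v)
    (fun _ _ hab ha => ha.trans (hH.hit_eq_of_adj hU hU' h hab)) huv rfl

theorem Consecutive.symm [Finite α] (hH : Consecutive σ U H) (hU : MeetsCycles σ U) :
    Consecutive σ⁻¹ U H := by
  intro x y hxy
  obtain ⟨hx, hy, e⟩ := hH x y hxy
  exact ⟨hx, hy, (e.imp (eq_hit_inv hU hx) (eq_hit_inv hU hy)).symm⟩

/-- An element of `U'` adjacent to a node `u` outside of `U'` is the last element of `U'` before `u`
or the first one after `u`. -/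
theorem Consecutive.eq_hit_of_adj [Finite α] (hH : Consecutive σ U H) (hU : MeetsCycles σ U)
    (hU' : MeetsCycles σ U') (h : U' ⊆ U) {u x : α} (hux : H.Adj u x) (hu : u ∉ U')
    (hx : x ∈ U') : x = hit σ U' u ∨ x = hit σ⁻¹ U' u := by
  have aux : ∀ τ : Equiv.Perm α, MeetsCycles τ U → MeetsCycles τ U' → x = hit τ U (τ u) →
      x = hit τ U' u := by
    intro τ h1 h2 e
    rw [hit_of_notMem h2 hu, ← hit_hit h1 h2 h, ← e, hit_of_mem hx]
  obtain ⟨huU, hxU, e | e⟩ := hH u x hux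
  · exact .inl (aux σ hU hU' e)
  · exact .inr (aux σ⁻¹ hU.symm hU'.symm (eq_hit_inv hU hxU e))

theorem Consecutive.contract [Finite α] (hH : Consecutive σ U H) (hU : MeetsCycles σ U)
    (hU' : MeetsCycles σ U') (h : U' ⊆ U) : Consecutive σ U' (contract H U') := by
  rintro x y ⟨hne, hx, hy, hxy | ⟨u, w, hux, hwy, hu, hw, hr⟩⟩
  · refine ⟨hx, hy, (hH x y hxy).2.2.imp ?_ ?_⟩
    · intro e
      rw [← hit_hit hU hU' h, ← e, hit_of_mem hy]
    · intro e
      rw [← hit_hit hU hU' h, ← e, hit_of_mem hx]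
  · have aux : hit σ U' u = hit σ U' (σ (hit σ⁻¹ U' u)) := by
      rw [hit_of_notMem hU' hu]
      have := hit_inv_hit hU'.symm u
      rw [inv_inv] at this
      exact this.symm
    have h1 := hH.hit_eq_of_reachable hU hU' h hr
    have h2 := (hH.symm hU).hit_eq_of_reachable hU.symm hU'.symm h hr
    refine ⟨hx, hy, ?_⟩
    rcases hH.eq_hit_of_adj hU hU' h hux hu hx with e1 | e1 <;>
      rcases hH.eq_hit_of_adj hU hU' h hwy hw hy with e2 | e2
    · exact absurd (e1.trans (h1.trans e2.symm)) hne
    · exact .inr (by rw [e2, ← h2, ← aux, e1])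
    · exact .inl (by rw [e1, ← aux, h1, e2])
    · exact absurd (e1.trans (h2.trans e2.symm)) hne

open Classical in
/-- The neighbors of a node in a graph. -/
noncomputable def nbrs [Fintype α] (H : SimpleGraph α) (v : α) : Finset α :=
  Finset.univ.filter fun w => H.Adj v w

@[simp]
theorem mem_nbrs [Fintype α] {v w : α} : w ∈ nbrs H v ↔ H.Adj v w := by
  simp [nbrs]

theorem Consecutive.card_nbrs_le [Fintype α] (hH : Consecutive σ U H) (hU : MeetsCycles σ U)
    (v : α) : (nbrs H v).card ≤ 2 := by
  classical
  refine (Finset.card_le_card (t := {hit σ U (σ v), hit σ⁻¹ U (σ⁻¹ v)}) ?_).trans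
    Finset.card_le_two
  intro w hw
  obtain ⟨hv, hw, e⟩ := hH v w (mem_nbrs.1 hw)
  rw [Finset.mem_insert, Finset.mem_singleton]
  exact e.imp id (eq_hit_inv hU hw)

/-- The time until `U'` is hit is a ranking of the nodes outside of `U'` as in
`isAcyclic_of_rank`: it decreases along `σ`. -/
theorem Consecutive.hitTime_lt_of_adj (hU : MeetsCycles σ U)
    (hU' : MeetsCycles σ U') (h : U' ⊆ U) {u v : α} (hu : u ∉ U') (e : v = hit σ U (σ u)) :
    hitTime σ U' v < hitTime σ U' u := by
  rw [e, hitTime_of_notMem hU' hu]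
  exact Nat.lt_succ_of_le (hitTime_hit_le hU hU' h _)

theorem Consecutive.hitTime_ne (hH : Consecutive σ U H) (hU : MeetsCycles σ U)
    (hU' : MeetsCycles σ U') (h : U' ⊆ U) (u v : α) (huv : (outside H U').Adj u v) :
    hitTime σ U' u ≠ hitTime σ U' v := by
  obtain ⟨hadj, hu, hv⟩ := huv
  rcases (hH u v hadj).2.2 with e | e
  · exact (hitTime_lt_of_adj hU hU' h hu e).ne'
  · exact (hitTime_lt_of_adj hU hU' h hv e).ne

theorem Consecutive.eq_of_hitTime_lt (hH : Consecutive σ U H) (hU : MeetsCycles σ U)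
    (hU' : MeetsCycles σ U') (h : U' ⊆ U) (u v w : α) (huv : (outside H U').Adj u v)
    (huw : (outside H U').Adj u w) (hv : hitTime σ U' v < hitTime σ U' u)
    (hw : hitTime σ U' w < hitTime σ U' u) : v = w := by
  have aux : ∀ v, (outside H U').Adj u v → hitTime σ U' v < hitTime σ U' u →
      v = hit σ U (σ u) := by
    rintro v ⟨hadj, -, hv'⟩ hlt
    rcases (hH u v hadj).2.2 with e | e
    · exact e
    · exact absurd (hitTime_lt_of_adj hU hU' h hv' e) hlt.not_gt
  rw [aux v huv hv, aux w huw hw]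

open Classical in
/-- The `m` nodes up to `z` along `σ`. -/
noncomputable def window (σ : Equiv.Perm α) (m : ℕ) (z : α) : Finset α :=
  (Finset.range m).image fun j => (σ⁻¹ ^ j) z

theorem mem_window {m : ℕ} {z v : α} : v ∈ window σ m z ↔ ∃ j < m, (σ⁻¹ ^ j) z = v := by
  simp [window]

/-- A component of `outside H U'` lies in the window before an element of `U'`. -/
theorem Consecutive.mem_window_of_reachable {m : ℕ} (hH : Consecutive σ U H) (hU : MeetsCycles σ U)
    (hU' : MeetsCycles σ U') (h : U' ⊆ U) (hm : ∀ u, hitTime σ U' u < m) {u v : α}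
    (huv : (outside H U').Reachable u v) : v ∈ window σ m (hit σ U' u) := by
  rw [hH.hit_eq_of_reachable hU hU' h huv]
  exact mem_window.2 ⟨hitTime σ U' v, hm v, by simp [hit]⟩

theorem Consecutive.mem_of_reachable (hH : Consecutive σ U H) {u v : α}
    (huv : (outside H U').Reachable u v) : v = u ∨ v ∈ U :=
  reachable_induction (P := fun v => v = u ∨ v ∈ U)
    (fun a b (hab : (outside H U').Adj a b) _ => .inr (hH a b hab.1).2.1) huv (.inl rfl)

end Cyclic

/-! ### Orienting cycles -/

section Orientation

variable {α β : Type*}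

/-- `σ` orients the cycles that make up `G`: it maps every node to a neighbor, these are all the
edges, and no node returns to itself in fewer than `m` steps. -/
structure Orients (σ : Equiv.Perm α) (G : SimpleGraph α) (m : ℕ) : Prop where
  adj_iff : ∀ u v, G.Adj u v ↔ v = σ u ∨ u = σ v
  pow_ne : ∀ v j, 0 < j → j < m → (σ ^ j) v ≠ v

theorem Orients.of_iso {σ : Equiv.Perm β} {G : SimpleGraph α} {G' : SimpleGraph β} {m : ℕ}
    (h : Orients σ G' m) (φ : G ≃g G') : Orients (φ.toEquiv.symm.permCongr σ) G m := by
  have hpow : ∀ j v, ((φ.toEquiv.symm.permCongr σ) ^ j) v = φ.symm ((σ ^ j) (φ v)) := by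
    intro j
    induction j with
    | zero => intro v; simp
    | succ j ih =>
      intro v
      rw [pow_succ', pow_succ', Equiv.Perm.mul_apply, ih, Equiv.permCongr_apply]
      simp
      rfl
  constructor
  · intro u v
    rw [← φ.map_adj_iff, h.adj_iff]
    have : ∀ a b : α, φ b = σ (φ a) ↔ b = φ.toEquiv.symm.permCongr σ a := by
      intro a b
      rw [Equiv.permCongr_apply, Equiv.eq_symm_apply]
      rfl
    rw [this, this]
  · intro v j hj hjm e
    rw [hpow] at e
    refine h.pow_ne (φ v) j hj hjm ?_
    have := congrArg φ e
    simpa using this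

open Fin.CommRing in
theorem orients_cycleGraph {k : ℕ} (hk : 3 ≤ k) :
    ∃ σ, Orients σ (SimpleGraph.cycleGraph k) k := by
  obtain ⟨k, rfl⟩ : ∃ k', k = k' + 3 := ⟨k - 3, by omega⟩
  refine ⟨Equiv.addRight 1, ?_, ?_⟩
  · intro u v
    rw [SimpleGraph.cycleGraph_adj, Equiv.coe_addRight, sub_eq_iff_eq_add', sub_eq_iff_eq_add',
      or_comm]
  · have hpow : ∀ (j : ℕ) (v : Fin (k + 3)), ((Equiv.addRight 1) ^ j) v =
        v + (j : Fin (k + 3)) := by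
      intro j
      induction j with
      | zero => simp
      | succ j ih =>
        intro v
        rw [pow_succ', Equiv.Perm.mul_apply, ih, Nat.cast_succ, ← add_assoc]
        rfl
    intro v j hj hjk e
    rw [hpow, add_eq_left, Fin.natCast_eq_zero] at e
    exact absurd (Nat.le_of_dvd hj e) (by omega)

theorem Orients.sum {σ : Equiv.Perm α} {τ : Equiv.Perm β} {G : SimpleGraph α} {G' : SimpleGraph β}
    {m : ℕ} (h : Orients σ G m) (h' : Orients τ G' m) : Orients (σ.sumCongr τ) (G ⊕g G') m := by
  constructor
  · rintro (u | u) (v | v)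
    · simpa using h.adj_iff u v
    · simp
    · simp
    · simpa using h'.adj_iff u v
  · have hpow : ∀ j, (σ.sumCongr τ) ^ j = (σ ^ j).sumCongr (τ ^ j) := by
      intro j
      induction j with
      | zero => simp
      | succ j ih => rw [pow_succ, ih, pow_succ, pow_succ, Equiv.Perm.sumCongr_mul]
    rintro (v | v) j hj hjm e
    · rw [hpow] at e
      exact h.pow_ne v j hj hjm (by simpa using e)
    · rw [hpow] at e
      exact h'.pow_ne v j hj hjm (by simpa using e)

theorem Orients.mono {σ : Equiv.Perm α} {G : SimpleGraph α} {m m' : ℕ} (h : Orients σ G m)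
    (hm : m' ≤ m) : Orients σ G m' :=
  ⟨h.adj_iff, fun v j hj hj' => h.pow_ne v j hj (hj'.trans_le hm)⟩

theorem IsOneCycle.orients {n : ℕ} {G : SimpleGraph (Fin n)} (h : IsOneCycle G) :
    ∃ σ, Orients σ G (n / 2) := by
  obtain ⟨hn, ⟨φ⟩⟩ := h
  obtain ⟨σ, hσ⟩ := orients_cycleGraph hn
  exact ⟨_, (hσ.of_iso φ).mono (Nat.div_le_self _ _)⟩

theorem IsTwoCycles.orients {n : ℕ} {G : SimpleGraph (Fin n)} (h : IsTwoCycles G) :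
    ∃ σ, Orients σ G (n / 2) := by
  obtain ⟨k, hk, hn, ⟨φ⟩⟩ := h
  obtain ⟨σ, hσ⟩ := orients_cycleGraph hk
  exact ⟨_, ((hσ.sum hσ).of_iso φ).mono (by omega)⟩

theorem IsOneCycle.reachable {n : ℕ} {G : SimpleGraph (Fin n)} (h : IsOneCycle G) (u v : Fin n) :
    G.Reachable u v := by
  obtain ⟨hn, ⟨φ⟩⟩ := h
  obtain ⟨n, rfl⟩ : ∃ k', n = k' + 1 := ⟨n - 1, by omega⟩
  exact (φ.connected_iff.2 SimpleGraph.cycleGraph_connected).preconnected u v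

theorem IsTwoCycles.exists_not_reachable {n : ℕ} {G : SimpleGraph (Fin n)} (h : IsTwoCycles G) :
    ∃ u v, ¬ G.Reachable u v := by
  obtain ⟨k, hk, hn, ⟨φ⟩⟩ := h
  refine ⟨φ.symm (.inl ⟨0, by omega⟩), φ.symm (.inr ⟨0, by omega⟩), fun hr => ?_⟩
  rw [SimpleGraph.Iso.reachable_iff] at hr
  exact SimpleGraph.not_reachable_sum_inl_inr _ _ hr

theorem Orients.reachable_pow {σ : Equiv.Perm α} {G : SimpleGraph α} {m : ℕ} (h : Orients σ G m)
    (v : α) (j : ℕ) : G.Reachable v ((σ ^ j) v) := by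
  induction j with
  | zero => exact .refl _
  | succ j ih =>
    rw [pow_succ', Equiv.Perm.mul_apply]
    exact ih.trans (SimpleGraph.Adj.reachable ((h.adj_iff _ _).2 (.inl rfl)))

/-- If `U` meets every cycle of `G` then `G` is connected as soon as `U` is connected in `G`. -/
theorem Orients.reachable_of_meetsCycles {σ : Equiv.Perm α} {G : SimpleGraph α} {m : ℕ}
    (h : Orients σ G m) {U : Finset α} (hU : MeetsCycles σ U)
    (hr : ∀ x ∈ U, ∀ y ∈ U, G.Reachable x y) (u v : α) : G.Reachable u v := by
  obtain ⟨i, hi⟩ := hU u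
  obtain ⟨j, hj⟩ := hU v
  exact (h.reachable_pow u i).trans ((hr _ hi _ hj).trans (h.reachable_pow v j).symm)

theorem Orients.consecutive_univ [Fintype α] {σ : Equiv.Perm α} {G : SimpleGraph α} {m : ℕ}
    (h : Orients σ G m) : Consecutive σ Finset.univ G := by
  intro x y hxy
  refine ⟨Finset.mem_univ _, Finset.mem_univ _, ?_⟩
  rw [hit_of_mem (Finset.mem_univ _), hit_of_mem (Finset.mem_univ _)]
  exact (h.adj_iff x y).1 hxy

open Classical in
/-- The `m` nodes from `v` on along `σ`. -/
noncomputable def arc (σ : Equiv.Perm α) (m : ℕ) (v : α) : Finset α :=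
  (Finset.range m).image fun j => (σ ^ j) v

theorem mem_arc {σ : Equiv.Perm α} {m : ℕ} {u v : α} : u ∈ arc σ m v ↔ ∃ j < m, (σ ^ j) v = u := by
  simp [arc]

theorem Orients.card_arc {σ : Equiv.Perm α} {G : SimpleGraph α} {m m' : ℕ}
    (h : Orients σ G m) (hm : m' ≤ m) (v : α) : (arc σ m' v).card = m' := by
  classical
  rw [arc, Finset.card_image_of_injOn, Finset.card_range]
  have key : ∀ i j, i < j → j < m' → (σ ^ i) v ≠ (σ ^ j) v := by
    intro i j hij hj e
    refine h.pow_ne v (j - i) (by omega) (by omega) ?_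
    have : (σ ^ i) ((σ ^ (j - i)) v) = (σ ^ i) v := by
      rw [← Equiv.Perm.mul_apply, ← pow_add, Nat.add_sub_cancel' hij.le, e]
    exact (σ ^ i).injective this
  intro i hi j hj e
  rw [Finset.mem_coe, Finset.mem_range] at hi hj
  rcases lt_trichotomy i j with hij | hij | hij
  · exact absurd e (key i j hij hj)
  · exact hij
  · exact absurd e.symm (key j i hij hi)

theorem exists_pow_mem_of_arc {σ : Equiv.Perm α} {m : ℕ} {v : α} {U : Finset α}
    (h : ∃ u ∈ arc σ m v, u ∈ U) : ∃ j < m, (σ ^ j) v ∈ U := by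
  obtain ⟨u, hu, huU⟩ := h
  obtain ⟨j, hj, rfl⟩ := mem_arc.1 hu
  exact ⟨j, hj, huU⟩

theorem card_window_le {σ : Equiv.Perm α} {m : ℕ} {z : α} : (window σ m z).card ≤ m := by
  classical
  exact Finset.card_image_le.trans (Finset.card_range m).le

end Orientation

/-! ### Random sampling -/

section Sampling

variable {n R : ℕ}

/-- The nodes of rank less than `p`. -/
def sample (r : Fin n → Fin R) (p : ℕ) : Finset (Fin n) :=
  Finset.univ.filter fun v => (r v).val < p

@[simp]
theorem mem_sample {r : Fin n → Fin R} {p : ℕ} {v : Fin n} : v ∈ sample r p ↔ (r v).val < p := by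
  simp [sample]

theorem sample_mono {r : Fin n → Fin R} {p q : ℕ} (h : p ≤ q) : sample r p ⊆ sample r q := by
  intro v
  simp only [mem_sample]
  omega

/-- The generating function of the number of nodes of `W` that are sampled: it factors over the
nodes, as their ranks are independent. -/
theorem sum_pow_card_sample (W : Finset (Fin n)) {p : ℕ} (hp : p ≤ R) (c : ℕ) :
    ∑ r : Fin n → Fin R, (c : ℝ) ^ (W ∩ sample r p).card =
      (R + (c - 1) * p : ℝ) ^ W.card * (R : ℝ) ^ (n - W.card) := by
  classical
  have h1 : ∀ r : Fin n → Fin R, (c : ℝ) ^ (W ∩ sample r p).card =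
      ∏ v, if v ∈ W ∧ (r v).val < p then (c : ℝ) else 1 := by
    intro r
    rw [Finset.prod_ite, Finset.prod_const, Finset.prod_const_one, mul_one]
    congr 2
    ext v
    simp
  have h2 : ∀ v, (∑ x : Fin R, if v ∈ W ∧ x.val < p then (c : ℝ) else 1) =
      if v ∈ W then (R + (c - 1) * p : ℝ) else R := by
    intro v
    by_cases hv : v ∈ W
    · have hcard : (Finset.univ.filter fun x : Fin R => x.val < p).card = p := by
        rw [Fin.card_filter_val_lt, min_eq_right hp]
      have : ∀ x : Fin R, (if x.val < p then (c : ℝ) else 1) =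
          1 + (c - 1) * (if x.val < p then 1 else 0) := by
        intro x
        split_ifs <;> ring
      simp only [hv, true_and, if_true, this]
      rw [Finset.sum_add_distrib, ← Finset.mul_sum, Finset.sum_boole, hcard]
      simp
    · simp [hv]
  calc ∑ r : Fin n → Fin R, (c : ℝ) ^ (W ∩ sample r p).card
      = ∑ r : Fin n → Fin R, ∏ v, if v ∈ W ∧ (r v).val < p then (c : ℝ) else 1 :=
        Finset.sum_congr rfl fun r _ => h1 r
    _ = ∏ v, ∑ x : Fin R, if v ∈ W ∧ x.val < p then (c : ℝ) else 1 := by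
        rw [Finset.prod_univ_sum, Fintype.piFinset_univ]
    _ = ∏ v, if v ∈ W then (R + (c - 1) * p : ℝ) else R :=
        Finset.prod_congr rfl fun v _ => h2 v
    _ = _ := by
        rw [Finset.prod_ite, Finset.prod_const, Finset.prod_const]
        congr 2
        · congr 1
          ext v
          simp
        · rw [← Finset.compl_filter, Finset.card_compl, Fintype.card_fin]
          congr 2
          ext v
          simp

open Classical in
/-- `W` contains no sampled node with probability at most `exp (-μ)`, where `μ` is at most the
expected number of sampled nodes. -/
theorem card_sample_eq_empty_le (hR : 0 < R) (W : Finset (Fin n)) {p : ℕ} (hp : p ≤ R) {μ : ℝ}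
    (hμ : μ * R ≤ W.card * p) :
    ((Finset.univ.filter fun r : Fin n → Fin R => W ∩ sample r p = ∅).card : ℝ) ≤
      Real.exp (-μ) * (R : ℝ) ^ n := by
  have hR' : (0 : ℝ) < R := by exact_mod_cast hR
  have hW : W.card ≤ n := by simpa using Finset.card_le_univ W
  have hn : (R : ℝ) ^ n = (R : ℝ) ^ W.card * (R : ℝ) ^ (n - W.card) := by
    rw [← pow_add, Nat.add_sub_cancel' hW]
  have h := sum_pow_card_sample W hp 0
  have h0 : ∀ r : Fin n → Fin R, ((0 : ℕ) : ℝ) ^ (W ∩ sample r p).card =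
      if W ∩ sample r p = ∅ then 1 else 0 := by
    intro r
    simp [zero_pow_eq, Finset.card_eq_zero]
  simp only [h0] at h
  rw [Finset.sum_boole] at h
  rw [h]
  have h3 : (R + ((0 : ℕ) - 1) * p : ℝ) ≤ R * Real.exp (-(p / R)) := by
    have := Real.add_one_le_exp (-(p / R : ℝ))
    calc (R + ((0 : ℕ) - 1) * p : ℝ) = R * (-(p / R) + 1) := by field_simp; push_cast; ring
      _ ≤ _ := by gcongr
  have h4 : (0 : ℝ) ≤ R + ((0 : ℕ) - 1) * p := by
    have : (p : ℝ) ≤ R := by exact_mod_cast hp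
    push_cast
    linarith
  calc (R + ((0 : ℕ) - 1) * p : ℝ) ^ W.card * (R : ℝ) ^ (n - W.card)
      ≤ (R * Real.exp (-(p / R))) ^ W.card * (R : ℝ) ^ (n - W.card) := by gcongr
    _ = Real.exp (-(W.card * p / R)) * (R : ℝ) ^ n := by
        rw [mul_pow, ← Real.exp_nat_mul]
        rw [hn]
        ring_nf
    _ ≤ Real.exp (-μ) * (R : ℝ) ^ n := by
        gcongr
        rwa [le_div_iff₀ hR']

open Classical in
/-- `W` contains more than `4 * μ` sampled nodes with probability at most `exp (-μ)`, where `μ` is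
at least the expected number of sampled nodes. -/
theorem card_lt_card_sample_le (hR : 0 < R) (W : Finset (Fin n)) {p : ℕ} (hp : p ≤ R) {μ : ℕ}
    (hμ : W.card * p ≤ μ * R) :
    ((Finset.univ.filter fun r : Fin n → Fin R => 4 * μ < (W ∩ sample r p).card).card : ℝ) ≤
      Real.exp (-μ) * (R : ℝ) ^ n := by
  have hR' : (0 : ℝ) < R := by exact_mod_cast hR
  have hW : W.card ≤ n := by simpa using Finset.card_le_univ W
  have hn : (R : ℝ) ^ n = (R : ℝ) ^ W.card * (R : ℝ) ^ (n - W.card) := by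
    rw [← pow_add, Nat.add_sub_cancel' hW]
  have h := sum_pow_card_sample W hp 2
  have h1 : ((Finset.univ.filter fun r : Fin n → Fin R =>
      4 * μ < (W ∩ sample r p).card).card : ℝ) * 2 ^ (4 * μ) ≤
      ∑ r : Fin n → Fin R, ((2 : ℕ) : ℝ) ^ (W ∩ sample r p).card := by
    rw [← nsmul_eq_mul, ← Finset.sum_const]
    refine (Finset.sum_le_sum (g := fun r : Fin n → Fin R =>
      ((2 : ℕ) : ℝ) ^ (W ∩ sample r p).card) ?_).trans
      (Finset.sum_le_sum_of_subset_of_nonneg (Finset.filter_subset _ _) fun _ _ _ => by positivity)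
    intro r hr
    rw [Finset.mem_filter] at hr
    push_cast
    exact pow_le_pow_right₀ (by norm_num) hr.2.le
  rw [h] at h1
  have h3 : (R + ((2 : ℕ) - 1) * p : ℝ) ≤ R * Real.exp (p / R) := by
    have := Real.add_one_le_exp (p / R : ℝ)
    calc (R + ((2 : ℕ) - 1) * p : ℝ) = R * (p / R + 1) := by field_simp; push_cast; ring
      _ ≤ _ := by gcongr
  have h4 : (R + ((2 : ℕ) - 1) * p : ℝ) ^ W.card * (R : ℝ) ^ (n - W.card) ≤
      Real.exp μ * (R : ℝ) ^ n :=
    calc (R + ((2 : ℕ) - 1) * p : ℝ) ^ W.card * (R : ℝ) ^ (n - W.card)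
        ≤ (R * Real.exp (p / R)) ^ W.card * (R : ℝ) ^ (n - W.card) := by
          have : (0 : ℝ) ≤ R + ((2 : ℕ) - 1) * p := by push_cast; linarith [p.cast_nonneg (α := ℝ)]
          gcongr
      _ = Real.exp (W.card * p / R) * (R : ℝ) ^ n := by
          rw [mul_pow, ← Real.exp_nat_mul]
          rw [hn]
          ring_nf
      _ ≤ Real.exp μ * (R : ℝ) ^ n := by
          gcongr
          rw [div_le_iff₀ hR']
          exact_mod_cast hμ
  -- `exp 2 ≤ 2 ^ 4`
  have h5 : Real.exp μ ≤ Real.exp (-μ) * 2 ^ (4 * μ) := by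
    have he : Real.exp 2 ≤ 2 ^ 4 := by
      have := Real.exp_one_lt_d9
      rw [show (2 : ℝ) = 1 + 1 by norm_num, Real.exp_add]
      nlinarith [Real.exp_pos 1]
    calc Real.exp μ = Real.exp (-μ) * Real.exp 2 ^ μ := by
          rw [← Real.exp_nat_mul, ← Real.exp_add]; ring_nf
      _ ≤ Real.exp (-μ) * (2 ^ 4) ^ μ := by gcongr
      _ = _ := by rw [← pow_mul]
  have h6 := h1.trans (h4.trans (mul_le_mul_of_nonneg_right h5 (by positivity)))
  rw [mul_right_comm] at h6
  exact le_of_mul_le_mul_right h6 (by positivity)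

end Sampling

/-! ### Protocols on arbitrary sets of machines and words -/

section Roles

variable {ι ω : Type}

/-- The local memories of the machines, and the messages just delivered: `C.2 j i` is the message
that `j` has received from `i`. -/
abbrev Snapshot (ι ω : Type) := (ι → List ω) × (ι → ι → List ω)

/-- A local computation: from its memory and the messages it has received, a machine computes its
new memory and the messages that it sends. -/
abbrev LocalStep (ι ω : Type) := ι → List ω → (ι → List ω) → List ω × (ι → List ω)

/-- One round of communication. -/
def LocalStep.apply (f : LocalStep ι ω) (C : Snapshot ι ω) : Snapshot ι ω :=
  (fun i => (f i (C.1 i) (C.2 i)).1, fun j i => (f i (C.1 i) (C.2 i)).2 j)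

/-- The snapshot after `t` rounds. -/
def run (init : ι → List ω) (f : ℕ → LocalStep ι ω) : ℕ → Snapshot ι ω
  | 0 => (init, fun _ _ => [])
  | t + 1 => (f t).apply (run init f t)

/-- No machine stores, has received, or has sent more than `S` words. -/
def Snapshot.Within [Fintype ι] (C : Snapshot ι ω) (S : ℕ) : Prop :=
  ∀ i, (C.1 i).length ≤ S ∧ ∑ j, (C.2 i j).length ≤ S ∧ ∑ j, (C.2 j i).length ≤ S

/-- The protocol given by its behavior on a set `ι` of machines and a set `ω` of words. -/
def Protocol.ofRoles {n M W : ℕ} {Out σ : Type} [Fintype σ] [Nonempty σ] (eι : ι ≃ Fin M)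
    (eω : ω ≃ Fin W) (init : σ → ι → Finset (Fin n) → Finset (Sym2 (Fin n)) → List ω)
    (step : σ → ℕ → LocalStep ι ω) (output : σ → ι → List ω → (ι → List ω) → Out) :
    Protocol n Out where
  machines := M
  words := W
  Seed := σ
  init s i X E := (init s (eι.symm i) X E).map eω
  step s t i l inbox :=
    let r := step s t (eι.symm i) (l.map eω.symm) fun j => (inbox (eι j)).map eω.symm
    (r.1.map eω, fun j => (r.2 (eι.symm j)).map eω)
  output s i l inbox :=
    output s (eι.symm i) (l.map eω.symm) fun j => (inbox (eι j)).map eω.symm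

variable {n M W : ℕ} {Out σ : Type} [Fintype σ] [Nonempty σ] (eι : ι ≃ Fin M)
    (eω : ω ≃ Fin W) (init : σ → ι → Finset (Fin n) → Finset (Sym2 (Fin n)) → List ω)
    (step : σ → ℕ → LocalStep ι ω) (output : σ → ι → List ω → (ι → List ω) → Out)

/-- The initial memory of the machines on a given input. -/
noncomputable def initialMemory (G : SimpleGraph (Fin n)) (p : Placement n M) (s : σ) (i : ι) :
    List ω :=
  init s i (p.nodesAt (eι i)) (p.edgesAt G (eι i))

theorem Protocol.config_succ {n : ℕ} {Out : Type} (P : Protocol n Out) (G : SimpleGraph (Fin n))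
    (p : Placement n P.machines) (s : P.Seed) (t : ℕ) : P.config G p s (t + 1) =
      { state := fun i =>
          (P.step s t i ((P.config G p s t).state i) ((P.config G p s t).inbox i)).1
        inbox := fun j i =>
          (P.step s t i ((P.config G p s t).state i) ((P.config G p s t).inbox i)).2 j } := rfl

theorem Protocol.config_ofRoles (G : SimpleGraph (Fin n)) (p : Placement n M) (s : σ) (t : ℕ) :
    (Protocol.ofRoles eι eω init step output).config G p s t =
      { state := fun i =>
          ((run (initialMemory eι init G p s) (step s) t).1 (eι.symm i)).map eω
        inbox := fun j i =>
          ((run (initialMemory eι init G p s) (step s) t).2 (eι.symm j) (eι.symm i)).map eω } := by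
  induction t with
  | zero => simp [Protocol.config, run, Protocol.ofRoles, initialMemory]
  | succ t ih =>
    refine (Protocol.config_succ (Protocol.ofRoles eι eω init step output) G p s t).trans ?_
    rw [ih]
    simp [run, LocalStep.apply, Protocol.ofRoles]

theorem Protocol.withinMemory_ofRoles [Fintype ι] {G : SimpleGraph (Fin n)} {p : Placement n M}
    {s : σ} {t S : ℕ}
    (h : (run (initialMemory eι init G p s) (step s) t).Within S) :
    ((Protocol.ofRoles eι eω init step output).config G p s t).WithinMemory S := by
  rw [Protocol.config_ofRoles]
  intro i
  obtain ⟨h1, h2, h3⟩ := h (eι.symm i)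
  exact ⟨(List.length_map _).trans_le h1,
    (Fintype.sum_equiv eι.symm _ _ fun _ => List.length_map _).trans_le h2,
    (Fintype.sum_equiv eι.symm _ _ fun _ => List.length_map _).trans_le h3⟩

theorem Protocol.result_ofRoles (G : SimpleGraph (Fin n)) (p : Placement n M) (s : σ) (t : ℕ)
    (i : Fin M) :
    (Protocol.ofRoles eι eω init step output).result G p s t i =
      output s (eι.symm i) ((run (initialMemory eι init G p s) (step s) t).1 (eι.symm i))
        ((run (initialMemory eι init G p s) (step s) t).2 (eι.symm i)) := by
  have h := Protocol.config_ofRoles eι eω init step output G p s t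
  unfold Protocol.result
  rw [h]
  simp [Protocol.ofRoles]

end Roles

/-! ### The simulating protocol -/

section Encoding

variable {n m W : ℕ}

/-- The machines of the simulating protocol: one for every node, and those of the simulated
protocol. -/
abbrev Role (n m : ℕ) := Fin n ⊕ Fin m

/-- The words of the simulating protocol: edges, nodes, and the words of the simulated protocol. -/
abbrev Word (n W : ℕ) := Sym2 (Fin n) ⊕ (Fin n ⊕ Fin W)

/-- A set of edges as a list of words. -/
noncomputable def encE (X : Finset (Sym2 (Fin n))) : List (Word n W) := X.toList.map .inl

/-- A set of nodes as a list of words. -/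
noncomputable def encV (X : Finset (Fin n)) : List (Word n W) := X.toList.map fun v => .inr (.inl v)

/-- A list of words of the simulated protocol. -/
def encA (l : List (Fin W)) : List (Word n W) := l.map fun a => .inr (.inr a)

/-- The edges in a list of words. -/
def decE (l : List (Word n W)) : Finset (Sym2 (Fin n)) := (l.filterMap Sum.getLeft?).toFinset

/-- The nodes in a list of words. -/
def decV (l : List (Word n W)) : Finset (Fin n) :=
  (l.filterMap fun a => a.getRight?.bind Sum.getLeft?).toFinset

/-- The words of the simulated protocol in a list of words. -/
def decA (l : List (Word n W)) : List (Fin W) :=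
  l.filterMap fun a => a.getRight?.bind Sum.getRight?

@[simp]
theorem decE_encE (X : Finset (Sym2 (Fin n))) : decE (encE X : List (Word n W)) = X := by
  simp [decE, encE, List.filterMap_map, Function.comp_def]

@[simp]
theorem decV_encV (X : Finset (Fin n)) : decV (encV X : List (Word n W)) = X := by
  simp [decV, encV, List.filterMap_map, Function.comp_def]

@[simp]
theorem decA_encA (l : List (Fin W)) : decA (encA l : List (Word n W)) = l := by
  simp [decA, encA, List.filterMap_map, Function.comp_def]

@[simp]
theorem decV_nil : decV ([] : List (Word n W)) = ∅ := rfl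

@[simp]
theorem decA_nil : decA ([] : List (Word n W)) = [] := rfl

@[simp]
theorem encA_nil : (encA [] : List (Word n W)) = [] := rfl

@[simp]
theorem length_encE (X : Finset (Sym2 (Fin n))) : (encE X : List (Word n W)).length = X.card := by
  simp [encE]

@[simp]
theorem length_encV (X : Finset (Fin n)) : (encV X : List (Word n W)).length = X.card := by
  simp [encV]

@[simp]
theorem length_encA (l : List (Fin W)) : (encA l : List (Word n W)).length = l.length := by
  simp [encA]

/-- All nodes that a machine has received. -/
def received (inbox : Role n m → List (Word n W)) : Finset (Fin n) :=
  Finset.univ.biUnion fun i => decV (inbox i)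

@[simp]
theorem mem_received {inbox : Role n m → List (Word n W)} {v : Fin n} :
    v ∈ received inbox ↔ ∃ i, v ∈ decV (inbox i) := by
  simp [received]

end Encoding

section Steps

variable {n N : ℕ} (hN : n ≤ N) (A : Protocol N (Fin N → Fin N)) (q : Placement N A.machines)
  (D : ℕ) (s : A.Seed) (U : Finset (Fin n))

/-- The local computations of the machines of the simulating protocol. -/
abbrev SimStep (n : ℕ) (A : Protocol N (Fin N → Fin N)) :=
  LocalStep (Role n A.machines) (Word n A.words)

/-- Every edge is sent to the machines of its endpoints. -/
noncomputable def distribute : SimStep n A := fun _ l _ =>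
  ([], Sum.elim (fun u => encV (Finset.univ.filter fun w => s(u, w) ∈ decE l)) fun _ => [])

open Classical in
/-- Every node that does not belong to `U` sends its edges to larger nodes outside of `U` to the
machines of the simulated protocol that have to hold these edges. -/
noncomputable def offer : SimStep n A
  | .inl v, l, inbox =>
    (encV (decV l ∪ received inbox), Sum.elim (fun _ => []) fun i =>
      encV ((decV l ∪ received inbox).filter fun w =>
        v < w ∧ v ∉ U ∧ w ∉ U ∧ q.edge s(v.castLE hN, w.castLE hN) = i))
  | .inr _, _, _ => ([], fun _ => [])

/-- The graph that a machine has been told: node `v` has sent some of its neighbors. -/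
def offered {m W : ℕ} (inbox : Role n m → List (Word n W)) : SimpleGraph (Fin n) :=
  SimpleGraph.fromRel fun v w => w ∈ decV (inbox (.inl v))

/-- The simulated protocol is initialized with the padded graph. -/
noncomputable def start : SimStep n A
  | .inl _, l, _ => (l, fun _ => [])
  | .inr i, _, inbox =>
    (encA (A.init s i (q.nodesAt i) (q.edgesAt (pad (offered inbox) N D) i)), fun _ => [])

/-- Round `t` of the simulated protocol. -/
def simulate (t : ℕ) : SimStep n A
  | .inl _, l, _ => (l, fun _ => [])
  | .inr i, l, inbox =>
    (encA (A.step s t i (decA l) fun j => decA (inbox (.inr j))).1, Sum.elim (fun _ => []) fun j =>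
      encA ((A.step s t i (decA l) fun j => decA (inbox (.inr j))).2 j))

open Classical in
/-- Every node is told the output of the simulated protocol for it. -/
noncomputable def announce : SimStep n A
  | .inl _, l, _ => (l, fun _ => [])
  | .inr i, l, inbox => ([], Sum.elim (fun v => if q.node (v.castLE hN) = i then
      encV (Finset.univ.filter fun w : Fin n => w.castLE hN =
        A.output s i (decA l) (fun j => decA (inbox (.inr j))) (v.castLE hN)) else []) fun _ => [])

/-- Every node outside of `U` sends its neighbors in `U` to the node that it has been told. -/
noncomputable def collect : SimStep n A
  | .inl v, l, inbox => (encV (if v ∈ U then decV l ∩ U else ∅), Sum.elim (fun x =>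
      encV (if v ∉ U ∧ x ∈ received inbox then decV l ∩ U else ∅)) fun _ => [])
  | .inr _, _, _ => ([], fun _ => [])

/-- Every node introduces the nodes that it has been told to each other. -/
noncomputable def spread : SimStep n A
  | .inl _, l, inbox => (l, Sum.elim (fun x =>
      encV (if x ∈ received inbox then (received inbox).erase x else ∅)) fun _ => [])
  | .inr _, _, _ => ([], fun _ => [])

/-- Every node sends its neighbors to the machine with index `0`. -/
noncomputable def report : SimStep n A
  | .inl _, l, inbox => ([], Sum.elim (fun x =>
      encV (if x.val = 0 then decV l ∪ received inbox else ∅)) fun _ => [])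
  | .inr _, _, _ => ([], fun _ => [])

end Steps

section Phase

variable {n N : ℕ} (hN : n ≤ N) (A : Protocol N (Fin N → Fin N)) (q : Placement N A.machines)
  (D : ℕ) (s : A.Seed) (U : Finset (Fin n)) (H : SimpleGraph (Fin n)) (lab : Fin n → Fin n)

/-- The snapshots of the machines of the simulating protocol. -/
abbrev SimSnapshot (n : ℕ) (A : Protocol N (Fin N → Fin N)) :=
  Snapshot (Role n A.machines) (Word n A.words)

/-- Every node knows its neighbors in `H`. -/
def Knows {A : Protocol N (Fin N → Fin N)} (C : SimSnapshot n A) (H : SimpleGraph (Fin n)) : Prop :=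
  ∀ v, decV (C.1 (.inl v)) ∪ received (C.2 (.inl v)) = nbrs H v

open Classical in
/-- The snapshot after `offer`. -/
noncomputable def offerSnap : SimSnapshot n A :=
  (Sum.elim (fun v => encV (nbrs H v)) fun _ => [], Sum.elim (fun _ _ => []) fun i =>
    Sum.elim (fun v => encV ((nbrs H v).filter fun w =>
        v < w ∧ v ∉ U ∧ w ∉ U ∧ q.edge s(v.castLE hN, w.castLE hN) = i)) fun _ => [])

/-- The snapshot during the simulation, when the simulated protocol has reached the configuration
`C`. -/
noncomputable def simSnap (C : Config A.machines A.words) : SimSnapshot n A :=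
  (Sum.elim (fun v => encV (nbrs H v)) fun i => encA (C.state i), Sum.elim (fun _ _ => []) fun j =>
    Sum.elim (fun _ => []) fun i => encA (C.inbox j i))

open Classical in
/-- The snapshot after `announce`. -/
noncomputable def announceSnap : SimSnapshot n A :=
  (Sum.elim (fun v => encV (nbrs H v)) fun _ => [], Sum.elim (fun v => Sum.elim (fun _ => [])
    fun i => if q.node (v.castLE hN) = i then encV {lab v} else []) fun _ _ => [])

/-- The snapshot after `collect`. -/
noncomputable def collectSnap : SimSnapshot n A :=
  (Sum.elim (fun v => encV (if v ∈ U then nbrs H v ∩ U else ∅)) fun _ => [],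
    Sum.elim (fun x => Sum.elim (fun v => encV (if v ∉ U ∧ x = lab v then nbrs H v ∩ U else ∅))
      fun _ => []) fun _ _ => [])

open Classical in
/-- The members of `U` adjacent to the component that is represented by `x`. -/
noncomputable def gathered (x : Fin n) : Finset (Fin n) :=
  Finset.univ.filter fun y => y ∈ U ∧ ∃ u, u ∉ U ∧ lab u = x ∧ H.Adj u y

/-- The snapshot after `spread`. -/
noncomputable def spreadSnap : SimSnapshot n A :=
  (Sum.elim (fun v => encV (if v ∈ U then nbrs H v ∩ U else ∅)) fun _ => [],
    Sum.elim (fun x => Sum.elim (fun v => encV (if x ∈ gathered U H lab v then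
      (gathered U H lab v).erase x else ∅)) fun _ => []) fun _ _ => [])

variable {A U H lab}

@[simp]
theorem mem_gathered {x y : Fin n} :
    y ∈ gathered U H lab x ↔ y ∈ U ∧ ∃ u, u ∉ U ∧ lab u = x ∧ H.Adj u y := by
  simp [gathered]

theorem apply_offer {C : SimSnapshot n A} (hC : Knows C H) :
    (offer hN A q U).apply C = offerSnap hN A q U H := by
  refine Prod.ext (funext ?_) (funext fun j => funext ?_)
  · rintro (v | i)
    · simp [LocalStep.apply, offer, offerSnap, hC v]
    · simp [LocalStep.apply, offer, offerSnap]
  · rintro (v | i)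
    · rcases j with x | j
      · simp [LocalStep.apply, offer, offerSnap]
      · simp [LocalStep.apply, offer, offerSnap, hC v]
    · rcases j with x | j <;> simp [LocalStep.apply, offer, offerSnap]

theorem mem_edgesAt {n M : ℕ} {p : Placement n M} {G : SimpleGraph (Fin n)} {i : Fin M}
    {e : Sym2 (Fin n)} : e ∈ p.edgesAt G i ↔ e ∈ G.edgeSet ∧ p.edge e = i := by
  simp [Placement.edgesAt]

theorem edgesAt_offered (i : Fin A.machines) :
    q.edgesAt (pad (offered ((offerSnap hN A q U H).2 (.inr i))) N D) i =
      q.edgesAt (pad (outside H U) N D) i := by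
  have key : ∀ u v : Fin n, q.edge s(u.castLE hN, v.castLE hN) = i →
      ((offered ((offerSnap hN A q U H).2 (.inr i))).Adj u v ↔ (outside H U).Adj u v) := by
    intro u v huv
    have hvu : q.edge s(v.castLE hN, u.castLE hN) = i := by rwa [Sym2.eq_swap]
    simp only [offered, offerSnap, SimpleGraph.fromRel_adj, Sum.elim_inr, Sum.elim_inl, decV_encV,
      Finset.mem_filter, mem_nbrs, outside, huv, hvu, and_true]
    constructor
    · rintro ⟨-, ⟨h1, -, h2, h3⟩ | ⟨h1, -, h2, h3⟩⟩
      · exact ⟨h1, h2, h3⟩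
      · exact ⟨h1.symm, h3, h2⟩
    · rintro ⟨h1, h2, h3⟩
      refine ⟨h1.ne, ?_⟩
      rcases lt_or_gt_of_ne h1.ne with h | h
      · exact .inl ⟨h1, h, h2, h3⟩
      · exact .inr ⟨h1.symm, h, h3, h2⟩
  ext e
  induction e with
  | _ a b =>
    rw [mem_edgesAt, mem_edgesAt, SimpleGraph.mem_edgeSet, SimpleGraph.mem_edgeSet]
    refine and_congr_left fun he => or_congr_left ?_
    refine exists_congr fun u => exists_congr fun v => ?_
    constructor
    · rintro ⟨h, h1, h2⟩
      obtain rfl : a = u.castLE hN := Fin.ext h1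
      obtain rfl : b = v.castLE hN := Fin.ext h2
      exact ⟨(key u v he).1 h, h1, h2⟩
    · rintro ⟨h, h1, h2⟩
      obtain rfl : a = u.castLE hN := Fin.ext h1
      obtain rfl : b = v.castLE hN := Fin.ext h2
      exact ⟨(key u v he).2 h, h1, h2⟩

theorem apply_start : (start A q D s).apply (offerSnap hN A q U H) =
    simSnap A H (A.config (pad (outside H U) N D) q s 0) := by
  refine Prod.ext (funext ?_) (funext fun j => funext ?_)
  · rintro (v | i)
    · simp [LocalStep.apply, start, offerSnap, simSnap]
    · simp only [LocalStep.apply, start, simSnap, Sum.elim_inr, Protocol.config,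
        edgesAt_offered]
  · rintro (v | i) <;> rcases j with x | j <;>
      simp [LocalStep.apply, start, simSnap, Protocol.config]

theorem apply_simulate {G : SimpleGraph (Fin N)} (t : ℕ) :
    (simulate A s t).apply (simSnap A H (A.config G q s t)) =
      simSnap A H (A.config G q s (t + 1)) := by
  refine Prod.ext (funext ?_) (funext fun j => funext ?_)
  · rintro (v | i) <;> simp [LocalStep.apply, simulate, simSnap, Protocol.config]
  · rintro (v | i) <;> rcases j with x | j <;>
      simp [LocalStep.apply, simulate, simSnap, Protocol.config]

theorem apply_announce {G : SimpleGraph (Fin N)} {T : ℕ}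
    (hout : ∀ v : Fin n, A.result G q s T (q.node (v.castLE hN)) (v.castLE hN) =
      (lab v).castLE hN) :
    (announce hN A q s).apply (simSnap A H (A.config G q s T)) = announceSnap hN A q H lab := by
  refine Prod.ext (funext ?_) (funext fun j => funext ?_)
  · rintro (v | i) <;> simp [LocalStep.apply, announce, simSnap, announceSnap]
  · rintro (v | i) <;> rcases j with x | j
    · simp [LocalStep.apply, announce, announceSnap]
    · simp [LocalStep.apply, announce, announceSnap]
    · simp only [LocalStep.apply, announce, simSnap, announceSnap, Sum.elim_inl, Sum.elim_inr,
        decA_encA]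
      split_ifs with h
      · have h1 := hout x
        rw [h] at h1
        congr 1
        ext w
        rw [Finset.mem_filter, Finset.mem_singleton]
        have : A.output s i ((A.config G q s T).state i) (fun j => (A.config G q s T).inbox i j)
          (x.castLE hN) = (lab x).castLE hN := h1
        rw [this]
        simp
      · rfl
    · simp [LocalStep.apply, announce, announceSnap]

theorem received_announceSnap (v : Fin n) :
    received ((announceSnap hN A q H lab).2 (.inl v)) = {lab v} := by
  ext x
  simp only [mem_received, Sum.exists, announceSnap, Sum.elim_inl, Sum.elim_inr, decV_nil,
    Finset.notMem_empty, exists_false, false_or, Finset.mem_singleton]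
  constructor
  · rintro ⟨i, hi⟩
    split_ifs at hi
    · simpa using hi
    · simp at hi
  · intro h
    exact ⟨q.node (v.castLE hN), by simp [h]⟩

theorem apply_collect : (collect A U).apply (announceSnap hN A q H lab) =
    collectSnap A U H lab := by
  refine Prod.ext (funext ?_) (funext fun j => funext ?_)
  · rintro (v | i)
    · simp [LocalStep.apply, collect, announceSnap, collectSnap]
    · simp [LocalStep.apply, collect, collectSnap]
  · rintro (v | i) <;> rcases j with x | j
    · simp only [LocalStep.apply, collect, received_announceSnap]
      simp [announceSnap, collectSnap]
    · simp [LocalStep.apply, collect, collectSnap]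
    · simp [LocalStep.apply, collect, collectSnap]
    · simp [LocalStep.apply, collect, collectSnap]

theorem received_collectSnap (x : Fin n) :
    received ((collectSnap A U H lab).2 (.inl x)) = gathered U H lab x := by
  ext y
  simp only [mem_received, Sum.exists, collectSnap, Sum.elim_inl, Sum.elim_inr, decV_nil,
    Finset.notMem_empty, exists_false, or_false, decV_encV, mem_gathered]
  constructor
  · rintro ⟨v, hv⟩
    split_ifs at hv with h
    · simp only [Finset.mem_inter, mem_nbrs] at hv
      exact ⟨hv.2, v, h.1, h.2.symm, hv.1⟩
    · simp at hv
  · rintro ⟨hy, v, hv, rfl, hvy⟩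
    exact ⟨v, by simp [hv, hvy, hy]⟩

theorem apply_spread : (spread A).apply (collectSnap A U H lab) = spreadSnap A U H lab := by
  refine Prod.ext (funext ?_) (funext fun j => funext ?_)
  · rintro (v | i) <;> simp [LocalStep.apply, spread, collectSnap, spreadSnap]
  · rintro (v | i) <;> rcases j with x | j
    · simp only [LocalStep.apply, spread, received_collectSnap]
      simp [spreadSnap]
    · simp [LocalStep.apply, spread, spreadSnap]
    · simp [LocalStep.apply, spread, spreadSnap]
    · simp [LocalStep.apply, spread, spreadSnap]

theorem knows_spreadSnap (hlab : ∀ u w, u ∉ U → w ∉ U →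
    (lab u = lab w ↔ (outside H U).Reachable u w)) :
    Knows (spreadSnap A U H lab) (contract H U) := by
  intro x
  ext y
  simp only [Finset.mem_union, mem_received, Sum.exists, spreadSnap, Sum.elim_inl, Sum.elim_inr,
    decV_nil, Finset.notMem_empty, exists_false, or_false, decV_encV, mem_nbrs]
  constructor
  · rintro (h | ⟨z, hz⟩)
    · split_ifs at h with hx
      · rw [Finset.mem_inter, mem_nbrs] at h
        exact ⟨h.1.ne, hx, h.2, .inl h.1⟩
      · simp at h
    · split_ifs at hz with hx
      · rw [Finset.mem_erase, mem_gathered] at hz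
        rw [mem_gathered] at hx
        obtain ⟨hxU, u, hu, hux, hadj⟩ := hx
        obtain ⟨hne, hyU, w, hw, hwx, hadj'⟩ := hz
        exact ⟨hne.symm, hxU, hyU, .inr ⟨u, w, hadj, hadj', hu, hw,
          (hlab u w hu hw).1 (hux.trans hwx.symm)⟩⟩
      · simp at hz
  · rintro ⟨hne, hx, hy, hxy | ⟨u, w, hux, hwy, hu, hw, hr⟩⟩
    · exact .inl (by simp [hx, hy, hxy])
    · right
      refine ⟨lab u, ?_⟩
      have hx' : x ∈ gathered U H lab (lab u) := mem_gathered.2 ⟨hx, u, hu, rfl, hux⟩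
      rw [if_pos hx', Finset.mem_erase, mem_gathered]
      exact ⟨hne.symm, hy, w, hw, ((hlab u w hu hw).2 hr).symm, hwy⟩

end Phase

/-! ### Memory and correctness of the simulating protocol -/

section Memory

variable {n N : ℕ} (hN : n ≤ N) (A : Protocol N (Fin N → Fin N)) (q : Placement N A.machines)
  (D : ℕ) (s : A.Seed) (U : Finset (Fin n)) (H : SimpleGraph (Fin n)) (lab : Fin n → Fin n)

/-- What is needed for a phase of the simulating protocol to succeed: the nodes of `H` have degree
at most two, the simulated protocol succeeds on the padded graph outside of `U`, and the components
of that graph, which are represented by `lab`, have at most `d` nodes. -/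
structure PhaseSucceeds (T S d : ℕ) : Prop where
  card_nbrs_le : ∀ v, (nbrs H v).card ≤ 2
  withinMemory : ∀ t ≤ T, (A.config (pad (outside H U) N D) q s t).WithinMemory S
  fits : q.Fits (pad (outside H U) N D) S
  result_eq : ∀ v : Fin n, A.result (pad (outside H U) N D) q s T (q.node (v.castLE hN))
    (v.castLE hN) = (lab v).castLE hN
  lab_eq_iff : ∀ u w, u ∉ U → w ∉ U → (lab u = lab w ↔ (outside H U).Reachable u w)
  card_lab_le : ∀ x, (Finset.univ.filter fun v => lab v = x).card ≤ d

variable {hN A q D s U H lab} {T S d : ℕ}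

theorem PhaseSucceeds.sum_offer_le (h : PhaseSucceeds hN A q D s U H lab T S d)
    (i : Fin A.machines) : ∑ v, ((offerSnap hN A q U H).2 (.inr i) (.inl v)).length ≤ S := by
  have h1 := h.fits i
  simp only [offerSnap, Sum.elim_inr, Sum.elim_inl, length_encV]
  rw [← Finset.card_sigma]
  refine le_trans ?_ (show (q.edgesAt (pad (outside H U) N D) i).card ≤ S by omega)
  refine Finset.card_le_card_of_injOn (fun x => s(x.1.castLE hN, x.2.castLE hN)) ?_ ?_
  · rintro ⟨v, w⟩ hvw
    simp only [Finset.coe_sigma, Set.mem_sigma_iff, Finset.mem_coe, Finset.mem_filter,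
      mem_nbrs] at hvw
    obtain ⟨-, h1, h2, h3, h4, h5⟩ := hvw
    rw [Finset.mem_coe, mem_edgesAt]
    exact ⟨(pad_adj_castLE hN).2 ⟨h1, h3, h4⟩, h5⟩
  · rintro ⟨v, w⟩ hvw ⟨v', w'⟩ hvw' he
    simp only [Finset.coe_sigma, Set.mem_sigma_iff, Finset.mem_coe, Finset.mem_filter,
      mem_nbrs] at hvw hvw'
    have hlt := hvw.2.2.1
    have hlt' := hvw'.2.2.1
    simp only [Sym2.eq_iff, Fin.castLE_inj] at he
    rcases he with ⟨rfl, rfl⟩ | ⟨rfl, rfl⟩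
    · rfl
    · exact absurd hlt hlt'.not_gt

theorem PhaseSucceeds.within_offerSnap (h : PhaseSucceeds hN A q D s U H lab T S d) (hS : 2 ≤ S) :
    (offerSnap hN A q U H).Within S := by
  rintro (v | i)
  · refine ⟨?_, ?_, ?_⟩
    · simpa [offerSnap] using (h.card_nbrs_le v).trans hS
    · simp [offerSnap]
    · simp only [Fintype.sum_sum_type, offerSnap, Sum.elim_inl, Sum.elim_inr, List.length_nil,
        Finset.sum_const_zero, zero_add, length_encV]
      refine le_trans ?_ ((h.card_nbrs_le v).trans hS)
      rw [Finset.card_eq_sum_card_fiberwise (f := fun w =>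
        q.edge s(v.castLE hN, w.castLE hN)) (t := Finset.univ)
        (fun _ _ => Finset.mem_coe.2 (Finset.mem_univ _))]
      refine Finset.sum_le_sum fun i _ => Finset.card_le_card ?_
      intro w
      simp only [Finset.mem_filter]
      tauto
  · refine ⟨by simp [offerSnap], ?_, by simp [offerSnap]⟩
    rw [Fintype.sum_sum_type]
    have := h.sum_offer_le i
    simpa [offerSnap] using this

theorem PhaseSucceeds.within_simSnap (h : PhaseSucceeds hN A q D s U H lab T S d) (hS : 2 ≤ S)
    {t : ℕ} (ht : t ≤ T) : (simSnap A H (A.config (pad (outside H U) N D) q s t)).Within S := by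
  rintro (v | i)
  · refine ⟨?_, by simp [simSnap], by simp [simSnap]⟩
    simpa [simSnap] using (h.card_nbrs_le v).trans hS
  · have := h.withinMemory t ht i
    simpa [simSnap] using this

theorem PhaseSucceeds.within_announceSnap (h : PhaseSucceeds hN A q D s U H lab T S d)
    (hS : 2 ≤ S) : (announceSnap hN A q H lab).Within S := by
  rintro (v | i)
  · refine ⟨?_, ?_, by simp [announceSnap]⟩
    · simpa [announceSnap] using (h.card_nbrs_le v).trans hS
    · simp only [Fintype.sum_sum_type, announceSnap, Sum.elim_inl, Sum.elim_inr, List.length_nil,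
        Finset.sum_const_zero, zero_add, apply_ite List.length, length_encV,
        Finset.card_singleton, Finset.sum_ite_eq, Finset.mem_univ, if_true]
      omega
  · refine ⟨by simp [announceSnap], by simp [announceSnap], ?_⟩
    have h1 := h.fits i
    simp only [Fintype.sum_sum_type, announceSnap, Sum.elim_inl, Sum.elim_inr, List.length_nil,
      Finset.sum_const_zero, add_zero, apply_ite List.length, length_encV, Finset.card_singleton,
      Finset.sum_boole, Nat.cast_id]
    refine le_trans ?_ (show (q.nodesAt i).card ≤ S by omega)
    refine Finset.card_le_card_of_injOn (Fin.castLE hN) ?_ (Fin.castLE_injective hN).injOn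
    intro v hv
    simpa [Placement.nodesAt] using hv

theorem PhaseSucceeds.card_gathered_le (h : PhaseSucceeds hN A q D s U H lab T S d) (x : Fin n) :
    (gathered U H lab x).card ≤ d * 2 := by
  refine le_trans (Finset.card_le_card (t := (Finset.univ.filter fun v => lab v = x).biUnion
    fun v => nbrs H v) ?_) ((Finset.card_biUnion_le_card_mul _ _ 2 fun v _ =>
      h.card_nbrs_le v).trans (Nat.mul_le_mul_right 2 (h.card_lab_le x)))
  intro y hy
  obtain ⟨-, u, -, hu, hadj⟩ := mem_gathered.1 hy
  simp only [Finset.mem_biUnion, Finset.mem_filter, Finset.mem_univ, true_and, mem_nbrs]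
  exact ⟨u, hu, hadj⟩

theorem PhaseSucceeds.card_ite_inter_le (h : PhaseSucceeds hN A q D s U H lab T S d) (v : Fin n)
    (P : Prop) [Decidable P] : (if P then nbrs H v ∩ U else ∅).card ≤ if P then 2 else 0 := by
  split_ifs
  · exact (Finset.card_le_card Finset.inter_subset_left).trans (h.card_nbrs_le v)
  · simp

theorem PhaseSucceeds.within_collectSnap (h : PhaseSucceeds hN A q D s U H lab T S d)
    (hd : 1 ≤ d) (hS : 4 * (d * d) ≤ S) : (collectSnap A U H lab).Within S := by
  have hd2 : d ≤ d * d := Nat.le_mul_of_pos_left d hd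
  rintro (v | i)
  · refine ⟨?_, ?_, ?_⟩
    · simp only [collectSnap, Sum.elim_inl, length_encV]
      refine (h.card_ite_inter_le v _).trans ?_
      split_ifs <;> omega
    · simp only [Fintype.sum_sum_type, collectSnap, Sum.elim_inl, Sum.elim_inr, List.length_nil,
        Finset.sum_const_zero, add_zero, length_encV]
      refine (Finset.sum_le_sum (g := fun u => if lab u = v then 2 else 0) fun u _ => ?_).trans ?_
      · refine (h.card_ite_inter_le u _).trans ?_
        by_cases hu : v = lab u
        · rw [if_pos hu.symm]
          split_ifs <;> omega
        · rw [if_neg fun hh => hu hh.2]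
          omega
      · rw [← Finset.sum_filter, Finset.sum_const, smul_eq_mul]
        have := h.card_lab_le v
        omega
    · simp only [Fintype.sum_sum_type, collectSnap, Sum.elim_inl, Sum.elim_inr, List.length_nil,
        Finset.sum_const_zero, add_zero, length_encV]
      refine (Finset.sum_le_sum (g := fun x => if x = lab v then 2 else 0) fun x _ => ?_).trans ?_
      · refine (h.card_ite_inter_le v _).trans ?_
        by_cases hu : x = lab v
        · rw [if_pos hu]
          split_ifs <;> omega
        · rw [if_neg fun hh => hu hh.2]
          omega
      · simp
        omega
  · exact ⟨by simp [collectSnap], by simp [collectSnap], by simp [collectSnap]⟩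

theorem PhaseSucceeds.within_spreadSnap (h : PhaseSucceeds hN A q D s U H lab T S d)
    (hd : 1 ≤ d) (hS : 4 * (d * d) ≤ S) : (spreadSnap A U H lab).Within S := by
  have hd2 : d ≤ d * d := Nat.le_mul_of_pos_left d hd
  have hite : ∀ (x v : Fin n), (if x ∈ gathered U H lab v then
      (gathered U H lab v).erase x else ∅).card ≤ if x ∈ gathered U H lab v then d * 2 else 0 := by
    intro x v
    split_ifs
    · exact (Finset.card_erase_le).trans (h.card_gathered_le v)
    · simp
  rintro (v | i)
  · refine ⟨?_, ?_, ?_⟩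
    · simp only [spreadSnap, Sum.elim_inl, length_encV]
      refine (h.card_ite_inter_le v _).trans ?_
      split_ifs <;> omega
    · simp only [Fintype.sum_sum_type, spreadSnap, Sum.elim_inl, Sum.elim_inr, List.length_nil,
        Finset.sum_const_zero, add_zero, length_encV]
      refine (Finset.sum_le_sum fun u _ => hite v u).trans ?_
      rw [← Finset.sum_filter, Finset.sum_const, smul_eq_mul]
      -- `v` is adjacent to at most two components
      have : (Finset.univ.filter fun u => v ∈ gathered U H lab u).card ≤ 2 := by
        refine (Finset.card_le_card (t := (nbrs H v).image lab) ?_).trans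
          (Finset.card_image_le.trans (h.card_nbrs_le v))
        intro x hx
        obtain ⟨-, u, -, hu, hadj⟩ := mem_gathered.1 (Finset.mem_filter.1 hx).2
        exact Finset.mem_image.2 ⟨u, mem_nbrs.2 hadj.symm, hu⟩
      calc _ ≤ 2 * (d * 2) := Nat.mul_le_mul_right _ this
        _ ≤ S := by omega
    · simp only [Fintype.sum_sum_type, spreadSnap, Sum.elim_inl, Sum.elim_inr, List.length_nil,
        Finset.sum_const_zero, add_zero, length_encV]
      refine (Finset.sum_le_sum fun u _ => hite u v).trans ?_
      rw [← Finset.sum_filter, Finset.sum_const, smul_eq_mul, Finset.filter_univ_mem]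
      calc _ ≤ (d * 2) * (d * 2) := Nat.mul_le_mul_right _ (h.card_gathered_le v)
        _ = 4 * (d * d) := by ring
        _ ≤ S := hS
  · exact ⟨by simp [spreadSnap], by simp [spreadSnap], by simp [spreadSnap]⟩

end Memory

section Distribution

variable {n N : ℕ} {A : Protocol N (Fin N → Fin N)} {M : ℕ} (e : Role n A.machines ≃ Fin M)
  (p : Placement n M) (G : SimpleGraph (Fin n))

/-- The initial memory of the simulating protocol: every machine stores its edges. -/
noncomputable def edgeMemory : Role n A.machines → List (Word n A.words) :=
  fun i => encE (p.edgesAt G (e i))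

theorem apply_distribute :
    (distribute A).apply (edgeMemory e p G, fun _ _ => []) =
      (fun _ => [], Sum.elim (fun u i => encV (Finset.univ.filter fun w =>
        s(u, w) ∈ p.edgesAt G (e i))) fun _ _ => []) := by
  refine Prod.ext rfl (funext fun j => funext fun i => ?_)
  rcases j with x | j
  · simp [LocalStep.apply, distribute, edgeMemory]
  · simp [LocalStep.apply, distribute]

theorem knows_distribute : Knows ((distribute A).apply (edgeMemory e p G, fun _ _ => [])) G := by
  intro u
  rw [apply_distribute]
  ext w
  simp only [decV_nil, Finset.empty_union, mem_received, Sum.elim_inl, decV_encV, mem_edgesAt,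
    Finset.mem_filter, Finset.mem_univ, true_and, SimpleGraph.mem_edgeSet, mem_nbrs]
  exact ⟨fun ⟨_, h, _⟩ => h, fun h => ⟨e.symm (p.edge s(u, w)), h, by simp⟩⟩

variable {e p G} {S : ℕ}

theorem within_edgeMemory (hp : p.Fits G S) :
    Snapshot.Within (edgeMemory (A := A) e p G, fun _ _ => []) S := by
  intro i
  have := hp (e i)
  refine ⟨?_, by simp, by simp⟩
  simp only [edgeMemory, length_encE]
  omega

theorem within_distribute (hp : p.Fits G S) (hdeg : ∀ v, (nbrs G v).card ≤ 2) (hS : 2 ≤ S) :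
    ((distribute A).apply (edgeMemory e p G, fun _ _ => [])).Within S := by
  classical
  rw [apply_distribute]
  -- every edge is sent to two nodes
  have hsent : ∀ i, ∑ u, (Finset.univ.filter fun w => s(u, w) ∈ p.edgesAt G i).card ≤ S := by
    intro i
    have h1 := hp i
    refine le_trans ?_ (show (p.edgesAt G i).card * 2 ≤ S by omega)
    rw [← Finset.card_sigma]
    refine le_trans (Finset.card_le_card (t := (p.edgesAt G i).biUnion fun e =>
      {⟨(Quot.out e).1, (Quot.out e).2⟩, ⟨(Quot.out e).2, (Quot.out e).1⟩}) ?_)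
      (Finset.card_biUnion_le_card_mul _ _ 2 fun _ _ => Finset.card_le_two)
    rintro ⟨u, w⟩ huw
    simp only [Finset.mem_sigma, Finset.mem_univ, Finset.mem_filter, true_and] at huw
    rw [Finset.mem_biUnion]
    refine ⟨s(u, w), huw, ?_⟩
    have : s((Quot.out s(u, w)).1, (Quot.out s(u, w)).2) = s(u, w) := Quot.out_eq s(u, w)
    rw [Sym2.eq_iff] at this
    rw [Finset.mem_insert, Finset.mem_singleton]
    rcases this with ⟨h1, h2⟩ | ⟨h1, h2⟩
    · exact .inl (by rw [h1, h2])
    · exact .inr (by rw [h1, h2])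
  have hrecv : ∀ u, ∑ i, (Finset.univ.filter fun w => s(u, w) ∈ p.edgesAt G (e i)).card ≤ S := by
    intro u
    refine le_trans ?_ ((hdeg u).trans hS)
    rw [Finset.card_eq_sum_card_fiberwise (f := fun w => e.symm (p.edge s(u, w)))
      (t := Finset.univ) (fun _ _ => Finset.mem_coe.2 (Finset.mem_univ _))]
    refine Finset.sum_le_sum fun i _ => Finset.card_le_card ?_
    intro w
    simp only [Finset.mem_filter, mem_edgesAt, Finset.mem_univ, true_and, mem_nbrs,
      SimpleGraph.mem_edgeSet, Equiv.symm_apply_eq]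
    exact id
  intro i
  refine ⟨by simp, ?_, ?_⟩
  · rcases i with u | i
    · simpa using hrecv u
    · simp
  · rw [Fintype.sum_sum_type]
    simpa using hsent (e i)

end Distribution

section Schedule

variable {n N : ℕ} (hN : n ≤ N) (A : Protocol N (Fin N → Fin N)) (q : Placement N A.machines)
  (D T K : ℕ) (s : A.Seed) (V : ℕ → Finset (Fin n))

/-- The `o`-th round of a phase, which takes `T + 5` rounds. -/
noncomputable def phaseStep (U : Finset (Fin n)) (o : ℕ) : SimStep n A :=
  if o = 0 then offer hN A q U
  else if o = 1 then start A q D s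
  else if o < T + 2 then simulate A s (o - 2)
  else if o = T + 2 then announce hN A q s
  else if o = T + 3 then collect A U
  else spread A

/-- The rounds of the simulating protocol: the edges are distributed, in phase `k < K` the nodes
outside of `V (k + 1)` are contracted, and the result is reported. -/
noncomputable def schedule : ℕ → SimStep n A
  | 0 => distribute A
  | t + 1 => if t / (T + 5) < K then phaseStep hN A q D T s (V (t / (T + 5) + 1)) (t % (T + 5))
    else report A

/-- The graph before phase `k`. -/
def level (G : SimpleGraph (Fin n)) (V : ℕ → Finset (Fin n)) : ℕ → SimpleGraph (Fin n)
  | 0 => G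
  | k + 1 => contract (level G V k) (V (k + 1))

variable {hN A q D T K s V} {M : ℕ} {e : Role n A.machines ≃ Fin M}
  {p : Placement n M} {G : SimpleGraph (Fin n)} {S d : ℕ}

theorem run_phase {f : ℕ → LocalStep (Role n A.machines) (Word n A.words)}
    {R : ℕ → SimSnapshot n A} (hR : ∀ t, R (t + 1) = (f t).apply (R t)) {U : Finset (Fin n)}
    {t₀ : ℕ} (hf : ∀ o < T + 5, f (t₀ + o) = phaseStep hN A q D T s U o) {H : SimpleGraph (Fin n)}
    (hknows : Knows (R t₀) H) {lab : Fin n → Fin n}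
    (h : PhaseSucceeds hN A q D s U H lab T S d) (hd : 1 ≤ d) (hS : 4 * (d * d) ≤ S) :
    Knows (R (t₀ + (T + 5))) (contract H U) ∧ ∀ o < T + 5, (R (t₀ + o + 1)).Within S := by
  have hS2 : 2 ≤ S := by nlinarith
  have hR' : ∀ o < T + 5, R (t₀ + o + 1) = (phaseStep hN A q D T s U o).apply (R (t₀ + o)) := by
    intro o ho
    rw [hR, hf o ho]
  have h1 : R (t₀ + 1) = offerSnap hN A q U H := by
    rw [← apply_offer hN q hknows]
    exact hR' 0 (by omega)
  have h2 : ∀ t ≤ T, R (t₀ + (t + 1) + 1) =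
      simSnap A H (A.config (pad (outside H U) N D) q s t) := by
    intro t
    induction t with
    | zero =>
      intro _
      rw [hR' _ (by omega), ← apply_start hN q D s, ← h1]
      simp [phaseStep]
    | succ t ih =>
      intro ht
      rw [hR' _ (by omega), ← apply_simulate, ← ih (by omega)]
      have : phaseStep hN A q D T s U (t + 1 + 1) = simulate A s t := by
        rw [phaseStep, if_neg (by omega), if_neg (by omega), if_pos (by omega)]
        rfl
      rw [this]
      rfl
  have h3 : R (t₀ + (T + 2) + 1) = announceSnap hN A q H lab := by
    rw [hR' _ (by omega), ← apply_announce hN q s h.result_eq, ← h2 T le_rfl]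
    simp [phaseStep]
    rfl
  have h4 : R (t₀ + (T + 3) + 1) = collectSnap A U H lab := by
    rw [hR' _ (by omega), ← apply_collect hN q, ← h3]
    simp [phaseStep]
    rfl
  have h5 : R (t₀ + (T + 4) + 1) = spreadSnap A U H lab := by
    rw [hR' _ (by omega), ← apply_spread, ← h4]
    simp [phaseStep]
    rfl
  refine ⟨?_, ?_⟩
  · rw [show t₀ + (T + 5) = t₀ + (T + 4) + 1 by ring, h5]
    exact knows_spreadSnap h.lab_eq_iff
  · intro o ho
    obtain rfl | ⟨t, ht, rfl⟩ | rfl | rfl | rfl : o = 0 ∨ (∃ t ≤ T, o = t + 1) ∨ o = T + 2 ∨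
        o = T + 3 ∨ o = T + 4 := by
      by_cases h0 : o = 0
      · exact .inl h0
      · by_cases h1 : o ≤ T + 1
        · exact .inr (.inl ⟨o - 1, by omega, by omega⟩)
        · omega
    · exact h1 ▸ h.within_offerSnap hS2
    · exact h2 t ht ▸ h.within_simSnap hS2 ht
    · exact h3 ▸ h.within_announceSnap hS2
    · exact h4 ▸ h.within_collectSnap hd hS
    · exact h5 ▸ h.within_spreadSnap hd hS

/-- Before phase `k`, every node knows its neighbors in the graph `level G V k`. -/
theorem run_schedule (hp : p.Fits G S) (hdeg : ∀ v, (nbrs G v).card ≤ 2) (hd : 1 ≤ d)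
    (hS : 4 * (d * d) ≤ S)
    (h : ∀ k < K, ∃ lab, PhaseSucceeds hN A q D s (V (k + 1)) (level G V k) lab T S d) :
    ∀ k ≤ K, Knows (run (edgeMemory e p G) (schedule hN A q D T K s V) (k * (T + 5) + 1))
        (level G V k) ∧
      ∀ t ≤ k * (T + 5) + 1,
        (run (edgeMemory e p G) (schedule hN A q D T K s V) t).Within S := by
  have hS2 : 2 ≤ S := by nlinarith
  intro k
  induction k with
  | zero =>
    intro _
    rw [zero_mul, zero_add]
    refine ⟨knows_distribute e p G, fun t ht => ?_⟩
    obtain rfl | rfl : t = 0 ∨ t = 1 := by omega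
    · exact within_edgeMemory hp
    · exact within_distribute hp hdeg hS2
  | succ k ih =>
    intro hk
    obtain ⟨ih1, ih2⟩ := ih (by omega)
    obtain ⟨lab, hlab⟩ := h k (by omega)
    have hdiv : ∀ o < T + 5, (k * (T + 5) + o) / (T + 5) = k ∧ (k * (T + 5) + o) % (T + 5) = o := by
      intro o ho
      rw [mul_comm, Nat.mul_add_div (by omega), Nat.div_eq_of_lt ho, Nat.mul_add_mod,
        Nat.mod_eq_of_lt ho]
      exact ⟨rfl, rfl⟩
    obtain ⟨h1, h2⟩ := run_phase
      (R := fun t => run (edgeMemory e p G) (schedule hN A q D T K s V) (t + 1))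
      (f := fun t => schedule hN A q D T K s V (t + 1)) (fun t => rfl) (t₀ := k * (T + 5))
      (U := V (k + 1)) (fun o ho => by
        simp only [schedule, (hdiv o ho).1, (hdiv o ho).2]
        rw [if_pos (by omega)]) ih1 hlab hd hS
    rw [show (k + 1) * (T + 5) = k * (T + 5) + (T + 5) by ring]
    refine ⟨h1, fun t ht => ?_⟩
    by_cases htk : t ≤ k * (T + 5) + 1
    · exact ih2 t htk
    · obtain ⟨o, rfl⟩ : ∃ o, t = k * (T + 5) + o + 1 + 1 := ⟨t - k * (T + 5) - 2, by omega⟩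
      exact h2 o (by omega)

open Classical in
/-- The output of the simulating protocol: whether the nodes of `U` are connected in the graph
that a machine has been told. -/
noncomputable def verdict {m W : ℕ} (U : Finset (Fin n)) (inbox : Role n m → List (Word n W)) :
    Bool :=
  decide (∀ x ∈ U, ∀ y ∈ U, (offered inbox).Reachable x y)

theorem verdict_eq_true {m W : ℕ} {U : Finset (Fin n)} {inbox : Role n m → List (Word n W)} :
    verdict U inbox = true ↔ ∀ x ∈ U, ∀ y ∈ U, (offered inbox).Reachable x y := by
  classical
  simp [verdict]

theorem apply_report {C : SimSnapshot n A} {H : SimpleGraph (Fin n)} (hC : Knows C H) :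
    (report A).apply C = (fun _ => [], Sum.elim (fun x => Sum.elim (fun v =>
      encV (if x.val = 0 then nbrs H v else ∅)) fun _ => []) fun _ _ => []) := by
  refine Prod.ext (funext ?_) (funext fun j => funext ?_)
  · rintro (v | i) <;> simp [LocalStep.apply, report]
  · rintro (v | i) <;> rcases j with x | j
    · simp [LocalStep.apply, report, hC v]
    · simp [LocalStep.apply, report]
    · simp [LocalStep.apply, report]
    · simp [LocalStep.apply, report]

theorem offered_apply_report {C : SimSnapshot n A} {H : SimpleGraph (Fin n)} (hC : Knows C H)
    {x : Fin n} (hx : x.val = 0) : offered (((report A).apply C).2 (.inl x)) = H := by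
  rw [apply_report hC]
  ext u v
  simp only [offered, SimpleGraph.fromRel_adj, Sum.elim_inl, hx, if_true, decV_encV, mem_nbrs]
  exact ⟨fun h => h.2.elim id SimpleGraph.Adj.symm, fun h => ⟨h.ne, .inl h⟩⟩

theorem within_report {C : SimSnapshot n A} {H : SimpleGraph (Fin n)} (hC : Knows C H)
    {U : Finset (Fin n)} (hU : ∀ v w, H.Adj v w → v ∈ U) (hdeg : ∀ v, (nbrs H v).card ≤ 2)
    (hS : 2 ≤ S) (hcard : U.card * 2 ≤ S) : ((report A).apply C).Within S := by
  classical
  rw [apply_report hC]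
  rintro (v | i)
  · refine ⟨by simp, ?_, ?_⟩
    · simp only [Fintype.sum_sum_type, Sum.elim_inl, Sum.elim_inr, List.length_nil,
        Finset.sum_const_zero, add_zero, length_encV]
      refine (Finset.sum_le_sum (g := fun u => if u ∈ U then 2 else 0) fun u _ => ?_).trans ?_
      · by_cases hu : u ∈ U
        · rw [if_pos hu]
          split_ifs
          · exact hdeg u
          · simp
        · have : nbrs H u = ∅ := Finset.eq_empty_of_forall_notMem fun w hw =>
            hu (hU u w (mem_nbrs.1 hw))
          simp [this]
      · rw [← Finset.sum_filter, Finset.sum_const, smul_eq_mul, Finset.filter_univ_mem]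
        exact hcard
    · simp only [Fintype.sum_sum_type, Sum.elim_inl, Sum.elim_inr, List.length_nil,
        Finset.sum_const_zero, add_zero, length_encV]
      refine (Finset.sum_le_sum (g := fun x : Fin n => if x = ⟨0, v.pos⟩ then 2 else 0)
        fun x _ => ?_).trans ?_
      · by_cases hx : x.val = 0
        · rw [if_pos (Fin.ext hx), if_pos hx]
          exact hdeg v
        · simp [hx]
      · simpa using hS
  · exact ⟨by simp, by simp, by simp⟩

/-- If all phases succeed then the simulating protocol respects the memory bounds and decides
whether the nodes of `V K` are connected in `level G V K`. -/
theorem run_schedule_final (hp : p.Fits G S) (hdeg : ∀ k ≤ K, ∀ v, (nbrs (level G V k) v).card ≤ 2)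
    (hd : 1 ≤ d) (hS : 4 * (d * d) ≤ S)
    (h : ∀ k < K, ∃ lab, PhaseSucceeds hN A q D s (V (k + 1)) (level G V k) lab T S d)
    (hK : ∀ v w, (level G V K).Adj v w → v ∈ V K) (hcard : (V K).card * 2 ≤ S) :
    (∀ t ≤ K * (T + 5) + 2,
      (run (edgeMemory e p G) (schedule hN A q D T K s V) t).Within S) ∧
    ∀ x : Fin n, x.val = 0 → (verdict (V K) ((run (edgeMemory e p G)
      (schedule hN A q D T K s V) (K * (T + 5) + 2)).2 (.inl x)) = true ↔
        ∀ u ∈ V K, ∀ v ∈ V K, (level G V K).Reachable u v) := by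
  obtain ⟨h1, h2⟩ := run_schedule (e := e) hp (hdeg 0 (Nat.zero_le K)) hd hS h K le_rfl
  have hrun : run (edgeMemory e p G) (schedule hN A q D T K s V) (K * (T + 5) + 2) =
      (report A).apply (run (edgeMemory e p G) (schedule hN A q D T K s V) (K * (T + 5) + 1)) := by
    rw [run]
    congr 1
    rw [schedule, if_neg]
    rw [Nat.mul_div_cancel _ (by omega)]
    omega
  constructor
  · intro t ht
    by_cases ht' : t ≤ K * (T + 5) + 1
    · exact h2 t ht'
    · rw [show t = K * (T + 5) + 2 by omega, hrun]
      exact within_report h1 hK (hdeg K le_rfl) (by nlinarith) hcard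
  · intro x hx
    rw [hrun, verdict_eq_true, offered_apply_report h1 hx]

end Schedule

/-! ### The phases on sampled nodes -/

section Levels

variable {n K D : ℕ} {σ : Equiv.Perm (Fin n)} {G : SimpleGraph (Fin n)} {V : ℕ → Finset (Fin n)}
  {m : ℕ → ℕ} {c : ℕ}

/-- The sets `V 0 ⊇ V 1 ⊇ ⋯` are spread evenly along the cycles of `σ`: any `m k` consecutive nodes
contain a member of `V (k + 1)` and at most `D` members of `V k`; and `V K` has at most `c`
elements. -/
structure EvenlySpread (σ : Equiv.Perm (Fin n)) (V : ℕ → Finset (Fin n)) (m : ℕ → ℕ)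
    (K D c : ℕ) : Prop where
  zero : V 0 = Finset.univ
  subset : ∀ k, V (k + 1) ⊆ V k
  hits : ∀ k < K, ∀ v, ∃ j < m k, (σ ^ j) v ∈ V (k + 1)
  card_window_le : ∀ k < K, ∀ z, (window σ (m k) z ∩ V k).card ≤ D
  card_le : (V K).card ≤ c

theorem EvenlySpread.meetsCycles (h : EvenlySpread σ V m K D c) {k : ℕ} (hk : k ≤ K) :
    MeetsCycles σ (V k) := by
  cases k with
  | zero => exact fun u => ⟨0, by simp [h.zero]⟩
  | succ k => exact fun u => (h.hits k hk u).imp fun j hj => hj.2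

theorem EvenlySpread.consecutive_level (h : EvenlySpread σ V m K D c) {l : ℕ}
    (hG : Orients σ G l) {k : ℕ} (hk : k ≤ K) : Consecutive σ (V k) (level G V k) := by
  induction k with
  | zero => exact h.zero ▸ hG.consecutive_univ
  | succ k ih =>
    exact (ih (by omega)).contract (h.meetsCycles (by omega)) (h.meetsCycles hk) (h.subset k)

theorem EvenlySpread.reachable_level_iff (h : EvenlySpread σ V m K D c) {k : ℕ} {x y : Fin n}
    (hx : x ∈ V k) (hy : y ∈ V k) : (level G V k).Reachable x y ↔ G.Reachable x y := by
  induction k with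
  | zero => rfl
  | succ k ih => rw [level, contract_reachable_iff hx hy, ih (h.subset k hx) (h.subset k hy)]

/-- A set of at most `D + 1` nodes that contains the component of `u` in phase `k`. -/
noncomputable def cluster (σ : Equiv.Perm (Fin n)) (V : ℕ → Finset (Fin n)) (m : ℕ → ℕ) (k : ℕ)
    (u : Fin n) : Finset (Fin n) :=
  insert u (window σ (m k) (hit σ (V (k + 1)) u) ∩ V k)

theorem EvenlySpread.card_cluster_le (h : EvenlySpread σ V m K D c) {k : ℕ} (hk : k < K)
    (u : Fin n) : (cluster σ V m k u).card ≤ D + 1 :=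
  (Finset.card_insert_le _ _).trans (Nat.succ_le_succ (h.card_window_le k hk _))

theorem EvenlySpread.mem_cluster (h : EvenlySpread σ V m K D c) {l : ℕ} (hG : Orients σ G l)
    {k : ℕ} (hk : k < K) {u v : Fin n}
    (huv : (outside (level G V k) (V (k + 1))).Reachable u v) : v ∈ cluster σ V m k u := by
  have hH := h.consecutive_level hG hk.le
  rw [cluster, Finset.mem_insert]
  refine (hH.mem_of_reachable huv).imp_right fun hv => Finset.mem_inter.2 ⟨?_, hv⟩
  exact hH.mem_window_of_reachable (h.meetsCycles hk.le) (h.meetsCycles hk) (h.subset k)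
    (fun u => hitTime_lt (h.hits k hk u)) huv

theorem EvenlySpread.pad_isAcyclic (h : EvenlySpread σ V m K D c) {l : ℕ} (hG : Orients σ G l)
    {k : ℕ} (hk : k < K) (N : ℕ) :
    (pad (outside (level G V k) (V (k + 1))) N D).IsAcyclic :=
  MPC.pad_isAcyclic (hitTime σ (V (k + 1)))
    ((h.consecutive_level hG hk.le).hitTime_ne (h.meetsCycles hk.le) (h.meetsCycles hk)
      (h.subset k))
    ((h.consecutive_level hG hk.le).eq_of_hitTime_lt (h.meetsCycles hk.le) (h.meetsCycles hk)
      (h.subset k))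

theorem EvenlySpread.maxComponentDiam_pad (h : EvenlySpread σ V m K D c) {l : ℕ}
    (hG : Orients σ G l) {k : ℕ} (hk : k < K) {N : ℕ} (hN : n + D < N) :
    maxComponentDiam (pad (outside (level G V k) (V (k + 1))) N D) = D :=
  MPC.maxComponentDiam_pad hN (cluster σ V m k) (fun _ _ huv => h.mem_cluster hG hk huv)
    (h.card_cluster_le hk)

end Levels

section Placing

variable {N M : ℕ}

/-- The nodes are dealt out to the machines in turn, and every edge is stored with its smaller
endpoint. -/
def dealt (N : ℕ) {M : ℕ} (hM : 0 < M) : Placement N M where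
  node v := ⟨v.val % M, Nat.mod_lt _ hM⟩
  edge e := ⟨e.inf.val % M, Nat.mod_lt _ hM⟩

theorem card_filter_mod_le (L i : ℕ) :
    (Finset.univ.filter fun a : Fin N => a.val < L ∧ a.val % M = i).card ≤ L / M + 1 := by
  rw [← Finset.card_range (L / M + 1)]
  refine Finset.card_le_card_of_injOn (fun a => a.val / M) ?_ ?_
  · intro a ha
    simp only [Finset.coe_filter, Finset.mem_univ, true_and, Set.mem_ofPred_eq] at ha
    simp only [Finset.coe_range, Set.mem_Iio]
    exact Nat.lt_succ_of_le (Nat.div_le_div_right ha.1.le)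
  · intro a ha b hb hab
    simp only [Finset.coe_filter, Finset.mem_univ, true_and, Set.mem_ofPred_eq] at ha hb
    simp only at hab
    apply Fin.ext
    rw [← Nat.div_add_mod a.val M, ← Nat.div_add_mod b.val M, hab, ha.2, hb.2]

/-- A graph of maximum degree two on the first `L` nodes fits if `L` is small compared to `N`. -/
theorem dealt_fits (hM : 0 < M) {G : SimpleGraph (Fin N)} {L S : ℕ} (hL : 8 * L ≤ N)
    (hS : 3 * N ≤ M * S) (hS' : 10 ≤ S) (hG : ∀ a b, G.Adj a b → a.val < L)
    (hdeg : ∀ a, (nbrs G a).card ≤ 2) : (dealt N hM).Fits G S := by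
  classical
  intro i
  have h1 : ((dealt N hM).nodesAt i).card ≤ N / M + 1 := by
    refine le_trans (Finset.card_le_card ?_) (card_filter_mod_le (N := N) (M := M) N i.val)
    intro v hv
    have hv' : (dealt N hM).node v = i := (Finset.mem_filter.1 hv).2
    exact Finset.mem_filter.2 ⟨Finset.mem_univ _, v.2, congrArg Fin.val hv'⟩
  have h2 : ((dealt N hM).edgesAt G i).card ≤ (L / M + 1) * 2 := by
    refine le_trans (Finset.card_le_card (t := (Finset.univ.filter fun a : Fin N =>
      a.val < L ∧ a.val % M = i.val).biUnion fun a => (nbrs G a).image fun b => s(a, b)) ?_)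
      ((Finset.card_biUnion_le_card_mul _ _ 2 fun a _ =>
        Finset.card_image_le.trans (hdeg a)).trans
          (Nat.mul_le_mul_right 2 (card_filter_mod_le L i.val)))
    intro e
    induction e with
    | _ a b =>
      rw [mem_edgesAt, SimpleGraph.mem_edgeSet]
      rintro ⟨hab, hi⟩
      have hi' : (a ⊓ b).val % M = i.val := congrArg Fin.val hi
      simp only [Finset.mem_biUnion, Finset.mem_filter, Finset.mem_univ, true_and,
        Finset.mem_image, mem_nbrs]
      rcases le_total a b with hle | hle
      · rw [inf_eq_left.2 hle] at hi'
        exact ⟨a, ⟨hG a b hab, hi'⟩, b, hab, rfl⟩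
      · rw [inf_eq_right.2 hle] at hi'
        exact ⟨b, ⟨hG b a hab.symm, hi'⟩, a, hab.symm, Sym2.eq_swap⟩
  have h3 : N / M + 4 * (L / M) + 5 ≤ S := by
    have h4 := Nat.div_mul_le_self N M
    have h5 := Nat.div_mul_le_self L M
    refine Nat.le_of_mul_le_mul_left ?_ hM
    nlinarith
  omega

theorem card_nbrs_pad_le {n D : ℕ} {F : SimpleGraph (Fin n)} (hN : n ≤ N)
    (hF : ∀ v, (nbrs F v).card ≤ 2) (a : Fin N) : (nbrs (pad F N D) a).card ≤ 2 := by
  classical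
  by_cases ha : a.val < n
  · refine (Finset.card_le_card (t := (nbrs F ⟨a, ha⟩).map (Fin.castLEEmb hN)) ?_).trans
      (by simpa using hF ⟨a, ha⟩)
    intro b hb
    obtain ⟨v, hv, hr⟩ := (pad_reachable_castLE (u := ⟨a, ha⟩) hN).1 (mem_nbrs.1 hb).reachable
    subst hv
    exact Finset.mem_map.2 ⟨v, mem_nbrs.2 ((pad_adj_castLE hN).1 (mem_nbrs.1 hb)), rfl⟩
  · rw [← Finset.card_map Fin.valEmbedding]
    refine (Finset.card_le_card (t := {a.val - 1, a.val + 1}) ?_).trans Finset.card_le_two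
    intro b' hb'
    obtain ⟨b, hb, rfl⟩ := Finset.mem_map.1 hb'
    rw [Finset.mem_insert, Finset.mem_singleton, Fin.valEmbedding_apply]
    rcases mem_nbrs.1 hb with ⟨u, v, h, h1, h2⟩ | ⟨h1, h2, h3, h4, h5⟩
    · have := u.2
      omega
    · omega

theorem outside_card_nbrs_le {n : ℕ} {H : SimpleGraph (Fin n)} {U : Finset (Fin n)}
    (hH : ∀ v, (nbrs H v).card ≤ 2) (v : Fin n) : (nbrs (outside H U) v).card ≤ 2 := by
  refine (Finset.card_le_card ?_).trans (hH v)
  intro w hw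
  exact mem_nbrs.2 (mem_nbrs.1 hw).1

theorem pad_adj_lt {n D : ℕ} {F : SimpleGraph (Fin n)} {a b : Fin N} (h : (pad F N D).Adj a b) :
    a.val < n + D + 1 := by
  rcases h with ⟨u, v, h, h1, h2⟩ | ⟨h1, h2, h3, h4, h5⟩
  · have := u.2
    omega
  · omega

end Placing

section PhaseSuccess

variable {n N : ℕ} {hN : n ≤ N} {A : Protocol N (Fin N → Fin N)} {q : Placement N A.machines}
  {s : A.Seed} {T S S' : ℕ} {K D : ℕ} {σ : Equiv.Perm (Fin n)} {G : SimpleGraph (Fin n)}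
  {V : ℕ → Finset (Fin n)} {m : ℕ → ℕ} {c : ℕ}

/-- The run of a protocol for connected components with the seed `s` is successful. -/
def CCSucceeds (A : Protocol N (Fin N → Fin N)) (G : SimpleGraph (Fin N))
    (q : Placement N A.machines) (s : A.Seed) (S T : ℕ) : Prop :=
  (∀ t ≤ T, (A.config G q s t).WithinMemory S) ∧
    ∀ v, IsGreatest {u | G.Reachable v u} (A.result G q s T (q.node v) v)

theorem EvenlySpread.phaseSucceeds (h : EvenlySpread σ V m K D c) {l : ℕ} (hG : Orients σ G l)
    {k : ℕ} (hk : k < K) (hS : S ≤ S')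
    (hfits : q.Fits (pad (outside (level G V k) (V (k + 1))) N D) S)
    (hA : CCSucceeds A (pad (outside (level G V k) (V (k + 1))) N D) q s S T) :
    ∃ lab, PhaseSucceeds hN A q D s (V (k + 1)) (level G V k) lab T S' (D + 1) := by
  obtain ⟨hmem, hres⟩ := hA
  have hex : ∀ v : Fin n, ∃ w : Fin n,
      A.result (pad (outside (level G V k) (V (k + 1))) N D) q s T (q.node (v.castLE hN))
        (v.castLE hN) = w.castLE hN ∧ (outside (level G V k) (V (k + 1))).Reachable v w :=
    fun v => (pad_reachable_castLE hN).1 (hres (v.castLE hN)).1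
  choose lab hlab hreach using hex
  have hiff : ∀ u w, lab u = lab w ↔ (outside (level G V k) (V (k + 1))).Reachable u w := by
    intro u w
    constructor
    · intro e
      exact (hreach u).trans (e ▸ (hreach w).symm)
    · intro hr
      have hr' := (pad_reachable_castLE (N := N) (D := D) hN).2 ⟨w, rfl, hr⟩
      have h1 := hres (u.castLE hN)
      have h2 := hres (w.castLE hN)
      rw [hlab] at h1 h2
      have hset : {x | (pad (outside (level G V k) (V (k + 1))) N D).Reachable (u.castLE hN) x} =
          {x | (pad (outside (level G V k) (V (k + 1))) N D).Reachable (w.castLE hN) x} := by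
        ext x
        exact ⟨fun hx => hr'.symm.trans hx, fun hx => hr'.trans hx⟩
      rw [hset] at h1
      exact Fin.castLE_injective hN (h1.unique h2)
  refine ⟨lab, ?_, ?_, ?_, hlab, fun u w _ _ => hiff u w, ?_⟩
  · exact (h.consecutive_level hG hk.le).card_nbrs_le (h.meetsCycles hk.le)
  · intro t ht i
    obtain ⟨h1, h2, h3⟩ := hmem t ht i
    exact ⟨h1.trans hS, h2.trans hS, h3.trans hS⟩
  · exact fun i => (hfits i).trans hS
  · intro x
    by_cases hx : ∃ v, lab v = x
    · obtain ⟨v, rfl⟩ := hx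
      refine (Finset.card_le_card ?_).trans (h.card_cluster_le hk v)
      intro w hw
      exact h.mem_cluster hG hk ((hiff v w).1 (Finset.mem_filter.1 hw).2.symm)
    · rw [Finset.filter_eq_empty_iff.2 fun v _ e => hx ⟨v, e⟩]
      simp

end PhaseSuccess

/-! ### The probability of success -/

section Probability

/-- A union bound: `b` is bad with probability at most `η`, and otherwise each of `K` events that
depend on `a` fails with probability at most `ε`. -/
theorem le_card_filter_prod {α β : Type} [Fintype α] [Fintype β] [DecidableEq α] [DecidableEq β]
    (good : α × β → Prop) {_ : DecidablePred good} (ok : ℕ → β → α → Prop)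
    [∀ k b, DecidablePred (ok k b)] (bad : Finset β) {K : ℕ} {ε η : ℝ} (hε : 0 ≤ ε)
    (hbad : (bad.card : ℝ) ≤ η * Fintype.card β)
    (hok : ∀ k < K, ∀ b ∉ bad, (1 - ε) * Fintype.card α ≤ (Finset.univ.filter (ok k b)).card)
    (hgood : ∀ b ∉ bad, ∀ a, (∀ k < K, ok k b a) → good (a, b)) :
    (1 - (K * ε + η)) * Fintype.card (α × β) ≤ (Finset.univ.filter good).card := by
  have hnot : ∀ k < K, ∀ b ∉ bad,
      ((Finset.univ.filter fun a => ¬ ok k b a).card : ℝ) ≤ ε * Fintype.card α := by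
    intro k hk b hb
    have h1 := Finset.card_filter_add_card_filter_not (s := Finset.univ) (ok k b)
    have h2 : ((Finset.univ.filter (ok k b)).card : ℝ) +
        (Finset.univ.filter fun a => ¬ ok k b a).card = Fintype.card α := by
      rw [← Finset.card_univ]
      exact_mod_cast h1
    have := hok k hk b hb
    linarith
  have hsub : (Finset.univ.filter fun x => ¬ good x) ⊆ (Finset.univ ×ˢ bad) ∪
      (Finset.range K).biUnion fun k => Finset.univ.filter fun x : α × β =>
        x.2 ∉ bad ∧ ¬ ok k x.2 x.1 := by
    rintro ⟨a, b⟩ hx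
    rw [Finset.mem_filter] at hx
    by_cases hb : b ∈ bad
    · exact Finset.mem_union_left _ (by simp [hb])
    · refine Finset.mem_union_right _ ?_
      have := mt (hgood b hb a) hx.2
      push Not at this
      obtain ⟨k, hk, hkok⟩ := this
      simp only [Finset.mem_biUnion, Finset.mem_range, Finset.mem_filter, Finset.mem_univ, true_and]
      exact ⟨k, hk, hb, hkok⟩
  have hk : ∀ k < K, ((Finset.univ.filter fun x : α × β =>
      x.2 ∉ bad ∧ ¬ ok k x.2 x.1).card : ℝ) ≤ ε * Fintype.card α * Fintype.card β := by
    intro k hk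
    have : (Finset.univ.filter fun x : α × β => x.2 ∉ bad ∧ ¬ ok k x.2 x.1) =
        (badᶜ.biUnion fun b => (Finset.univ.filter fun a => ¬ ok k b a) ×ˢ {b}) := by
      ext ⟨a, b⟩
      simp [and_comm]
    rw [this]
    refine (Nat.cast_le.2 Finset.card_biUnion_le).trans ?_
    push_cast
    refine (Finset.sum_le_sum (g := fun _ => ε * Fintype.card α) fun b hb => ?_).trans ?_
    · rw [Finset.card_product, Finset.card_singleton, mul_one]
      exact hnot k hk b (Finset.mem_compl.1 hb)
    · rw [Finset.sum_const, nsmul_eq_mul, mul_comm]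
      refine mul_le_mul_of_nonneg_left ?_ (by positivity)
      exact_mod_cast Finset.card_le_univ _
  have hle := Nat.cast_le (α := ℝ).2 ((Finset.card_le_card hsub).trans (Finset.card_union_le _ _))
  push_cast at hle
  have h3 : (((Finset.range K).biUnion fun k => Finset.univ.filter fun x : α × β =>
      x.2 ∉ bad ∧ ¬ ok k x.2 x.1).card : ℝ) ≤ K * (ε * Fintype.card α * Fintype.card β) := by
    refine (Nat.cast_le.2 Finset.card_biUnion_le).trans ?_
    push_cast
    refine (Finset.sum_le_sum fun k hkK => hk k (Finset.mem_range.1 hkK)).trans ?_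
    simp
  have h4 : ((Finset.univ ×ˢ bad : Finset (α × β)).card : ℝ) ≤
      Fintype.card α * (η * Fintype.card β) := by
    rw [Finset.card_product, Finset.card_univ]
    push_cast
    gcongr
  have h5 : ((Finset.univ.filter good).card : ℝ) + (Finset.univ.filter fun x => ¬ good x).card =
      Fintype.card α * Fintype.card β := by
    have := Finset.card_filter_add_card_filter_not (s := Finset.univ) good
    rw [Finset.card_univ, Fintype.card_prod] at this
    exact_mod_cast this
  rw [Fintype.card_prod]
  push_cast
  linarith

variable {n B K L : ℕ}

/-- The nodes that remain before phase `k`: their density is `B ^ (-k)`. -/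
def samples (B K : ℕ) (r : Fin n → Fin (B ^ K)) (k : ℕ) : Finset (Fin n) := sample r (B ^ (K - k))

open Classical in
/-- Samples are not evenly spread with exponentially small probability. The windows of phase `k`
have `L * B ^ (k + 1)` nodes, of which `L` are expected to be sampled before phase `k + 1`, and
`L * B` before phase `k`. -/
theorem card_not_evenlySpread_le (hB : 0 < B) (hn : n ≤ 2 * (L * B) * B ^ K)
    {σ : Equiv.Perm (Fin n)} {G : SimpleGraph (Fin n)} (hG : Orients σ G (n / 2))
    (hL : L * B ^ K ≤ n / 2) :
    ((Finset.univ.filter fun r : Fin n → Fin (B ^ K) => ¬ EvenlySpread σ (samples B K r)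
      (fun k => L * B ^ (k + 1)) K (4 * (L * B)) (8 * (L * B))).card : ℝ) ≤
      (2 * K * n + 1) * Real.exp (-L) * Fintype.card (Fin n → Fin (B ^ K)) := by
  have hR : 0 < B ^ K := Nat.pow_pos hB
  have hLB : L ≤ L * B := Nat.le_mul_of_pos_right L hB
  have hpow : ∀ k, B ^ (K - k) ≤ B ^ K := fun k => Nat.pow_le_pow_right hB (Nat.sub_le _ _)
  have hsplit : ∀ k < K, B ^ (k + 1) * B ^ (K - (k + 1)) = B ^ K := by
    intro k hk
    rw [← pow_add]
    congr 1
    omega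
  let E1 : ℕ → Fin n → Finset (Fin n → Fin (B ^ K)) := fun k v => Finset.univ.filter fun r =>
    arc σ (L * B ^ (k + 1)) v ∩ samples B K r (k + 1) = ∅
  let E2 : ℕ → Fin n → Finset (Fin n → Fin (B ^ K)) := fun k z => Finset.univ.filter fun r =>
    4 * (L * B) < (window σ (L * B ^ (k + 1)) z ∩ samples B K r k).card
  let E3 : Finset (Fin n → Fin (B ^ K)) := Finset.univ.filter fun r =>
    4 * (2 * (L * B)) < (Finset.univ ∩ samples B K r K).card
  have hsub : (Finset.univ.filter fun r : Fin n → Fin (B ^ K) => ¬ EvenlySpread σ (samples B K r)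
      (fun k => L * B ^ (k + 1)) K (4 * (L * B)) (8 * (L * B))) ⊆
      ((Finset.range K).biUnion fun k => Finset.univ.biUnion fun v => E1 k v ∪ E2 k v) ∪ E3 := by
    intro r hr
    by_contra hcon
    refine (Finset.mem_filter.1 hr).2 ?_
    simp only [Finset.mem_union, Finset.mem_biUnion, Finset.mem_range, Finset.mem_univ, true_and,
      not_or, not_exists, not_and, E1, E2, E3, Finset.mem_filter, not_lt,
      Finset.univ_inter] at hcon
    obtain ⟨h12, h3⟩ := hcon
    refine ⟨?_, ?_, ?_, ?_, by omega⟩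
    · ext v
      simp [samples]
    · exact fun k => sample_mono (Nat.pow_le_pow_right hB (by omega))
    · intro k hk v
      obtain ⟨u, hu⟩ := Finset.nonempty_iff_ne_empty.2 (h12 k hk v).1
      rw [Finset.mem_inter] at hu
      exact exists_pow_mem_of_arc ⟨u, hu⟩
    · exact fun k hk z => (h12 k hk z).2
  have hE1 : ∀ k < K, ∀ v, ((E1 k v).card : ℝ) ≤
      Real.exp (-L) * ((B ^ K : ℕ) : ℝ) ^ n := by
    intro k hk v
    refine card_sample_eq_empty_le hR _ (hpow _) ?_
    have hle : L * B ^ (k + 1) ≤ n / 2 :=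
      (Nat.mul_le_mul_left L (Nat.pow_le_pow_right hB (by omega))).trans hL
    rw [hG.card_arc hle, ← hsplit k hk]
    push_cast
    exact le_of_eq (by ring)
  have hE2 : ∀ k < K, ∀ z, ((E2 k z).card : ℝ) ≤
      Real.exp (-L) * ((B ^ K : ℕ) : ℝ) ^ n := by
    intro k hk z
    refine (card_lt_card_sample_le hR _ (hpow _) ?_).trans ?_
    · refine (Nat.mul_le_mul_right _ card_window_le).trans (le_of_eq ?_)
      rw [mul_assoc, ← pow_add, show k + 1 + (K - k) = K + 1 by omega, pow_succ]
      ring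
    · gcongr
  have hE3 : (E3.card : ℝ) ≤ Real.exp (-L) * ((B ^ K : ℕ) : ℝ) ^ n := by
    refine (card_lt_card_sample_le hR _ (hpow _) ?_).trans ?_
    · simpa using hn
    · gcongr
      exact_mod_cast (by omega : L ≤ 2 * (L * B))
  refine (Nat.cast_le.2 ((Finset.card_le_card hsub).trans (Finset.card_union_le _ _))).trans ?_
  have hcard : (Fintype.card (Fin n → Fin (B ^ K)) : ℝ) = ((B ^ K : ℕ) : ℝ) ^ n := by
    rw [Fintype.card_fun, Fintype.card_fin, Fintype.card_fin]
    push_cast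
    rfl
  rw [hcard]
  have h12 : (((Finset.range K).biUnion fun k =>
      Finset.univ.biUnion fun v => E1 k v ∪ E2 k v).card : ℝ) ≤
      K * (n * (2 * (Real.exp (-L) * ((B ^ K : ℕ) : ℝ) ^ n))) := by
    refine (Nat.cast_le.2 Finset.card_biUnion_le).trans ?_
    push_cast
    refine (Finset.sum_le_sum (g := fun _ =>
      (n * (2 * (Real.exp (-L) * ((B ^ K : ℕ) : ℝ) ^ n)) : ℝ)) fun k hk => ?_).trans (by simp)
    refine (Nat.cast_le.2 Finset.card_biUnion_le).trans ?_
    push_cast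
    refine (Finset.sum_le_sum (g := fun _ =>
      (2 * (Real.exp (-L) * ((B ^ K : ℕ) : ℝ) ^ n) : ℝ)) fun v _ => ?_).trans (by simp)
    refine (Nat.cast_le.2 (Finset.card_union_le _ _)).trans ?_
    have h1 := hE1 k (Finset.mem_range.1 hk) v
    have h2 := hE2 k (Finset.mem_range.1 hk) v
    push_cast at h1 h2 ⊢
    linarith
  push_cast at h12 hE3 ⊢
  nlinarith

end Probability

/-! ### The reduction for given parameters -/

section Reduction

variable {n N : ℕ}

/-- The protocol for 1-vs-2-cycles that simulates a protocol for connected components in each of `K`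
phases. -/
noncomputable def cycleProtocol (hN : n ≤ N) (A : Protocol N (Fin N → Fin N))
    (q : Placement N A.machines) (D T B K : ℕ) [NeZero B] : Protocol n Bool :=
  Protocol.ofRoles (σ := A.Seed × (Fin n → Fin (B ^ K)))
    (finSumFinEquiv : Role n A.machines ≃ Fin (n + A.machines))
    (Fintype.equivFin (Word n A.words)) (fun _ _ _ E => encE E)
    (fun x => schedule hN A q D T K x.1 (samples B K x.2))
    (fun x _ _ inbox => verdict (samples B K x.2 K) inbox)

variable {A : Protocol N (Fin N → Fin N)} {D S S' T B K L : ℕ} [NeZero B]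

open Classical in
theorem Protocol.le_successProb_iff {Out : Type} (P : Protocol n Out) (G : SimpleGraph (Fin n))
    (p : Placement n P.machines) (S T : ℕ) (good : (Fin P.machines → Out) → Prop) (x : ℝ) :
    x ≤ P.successProb G p S T good ↔ x * Fintype.card P.Seed ≤
      ((Finset.univ.filter fun s : P.Seed =>
        (∀ t ≤ T, (P.config G p s t).WithinMemory S) ∧ good (P.result G p s T)).card : ℝ) := by
  rw [Protocol.successProb, le_div_iff₀ (by exact_mod_cast Fintype.card_pos)]

/-- The parameters: a phase reduces the number of nodes by a factor of about `B`, and `L` makes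
failures unlikely. -/
theorem cycleProtocol_solves (hN : n ≤ N) (hM : 0 < A.machines) (hn : 0 < n)
    (hNn : 8 * (n + D + 1) ≤ N)
    (hA : A.SolvesCCOnForests D S T) (hMS : 3 * N ≤ A.machines * S) (hS : 10 ≤ S) (hSS : S ≤ S')
    (hD : D = 4 * (L * B)) (hS' : 4 * ((D + 1) * (D + 1)) ≤ S')
    (hnB : n ≤ 2 * (L * B) * B ^ K) (hL : L * B ^ K ≤ n / 2)
    (hprob : (K : ℝ) * (1 / N) + (2 * K * n + 1) * Real.exp (-L) ≤ 1 / n) :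
    (cycleProtocol hN A (dealt N hM) D T B K).SolvesOneVsTwoCycles S' (K * (T + 5) + 2) := by
  classical
  have hB : 0 < B := Nat.pos_of_ne_zero (NeZero.ne B)
  -- The two cases differ only in the correct answer.
  have main : ∀ (G : SimpleGraph (Fin n)) (p : Placement n (n + A.machines)), p.Fits G S' →
      ∀ σ, Orients σ G (n / 2) → ∀ b : Bool, (b = true ↔ ∀ u v, G.Reachable u v) →
      1 - 1 / (n : ℝ) ≤ (cycleProtocol hN A (dealt N hM) D T B K).successProb G p S'
        (K * (T + 5) + 2) fun out => ∀ i : Fin (n + A.machines), i.val = 0 → out i = b := by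
    intro G p hp σ hσ b hb
    refine (Protocol.le_successProb_iff (cycleProtocol hN A (dealt N hM) D T B K) G p S' _ _ _).2 ?_
    refine le_trans ?_ (le_card_filter_prod
      (α := A.Seed) (β := Fin n → Fin (B ^ K)) (K := K) (ε := 1 / N)
      (η := (2 * K * n + 1) * Real.exp (-L)) _
      (fun k r s => CCSucceeds A (pad (outside (level G (samples B K r) k)
        (samples B K r (k + 1))) N D) (dealt N hM) s S T)
      (Finset.univ.filter fun r : Fin n → Fin (B ^ K) => ¬ EvenlySpread σ (samples B K r)
        (fun k => L * B ^ (k + 1)) K (4 * (L * B)) (8 * (L * B))) (by positivity)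
      (card_not_evenlySpread_le hB hnB hσ hL) ?_ ?_)
    · exact mul_le_mul_of_nonneg_right (by linarith) (by positivity)
    · intro k hk r hr
      simp only [Finset.mem_filter, Finset.mem_univ, true_and, not_not] at hr
      rw [← hD] at hr
      have hfits : (dealt N hM).Fits (pad (outside (level G (samples B K r) k)
          (samples B K r (k + 1))) N D) S :=
        dealt_fits hM hNn hMS hS (fun _ _ => pad_adj_lt) (card_nbrs_pad_le hN
          (outside_card_nbrs_le ((hr.consecutive_level hσ hk.le).card_nbrs_le
            (hr.meetsCycles hk.le))))
      have := hA _ (dealt N hM) (hr.pad_isAcyclic hσ hk N)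
        (hr.maxComponentDiam_pad hσ hk (by omega)) hfits
      refine ((Protocol.le_successProb_iff _ _ _ _ _ _ _).1 this).trans (le_of_eq ?_)
      congr!
    · intro r hr s hs
      simp only [Finset.mem_filter, Finset.mem_univ, true_and, not_not] at hr
      rw [← hD] at hr
      have hdeg : ∀ k ≤ K, ∀ v, (nbrs (level G (samples B K r) k) v).card ≤ 2 := fun k hk =>
        (hr.consecutive_level hσ hk).card_nbrs_le (hr.meetsCycles hk)
      obtain ⟨hmem, hverdict⟩ := run_schedule_final
        (e := (finSumFinEquiv : Role n A.machines ≃ Fin (n + A.machines)))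
        (p := p) (hN := hN) (q := dealt N hM) (T := T) (s := s) hp hdeg (Nat.le_add_left 1 D) hS'
        (fun k hk => hr.phaseSucceeds hσ hk hSS (dealt_fits hM hNn hMS hS
          (fun _ _ => pad_adj_lt) (card_nbrs_pad_le hN (outside_card_nbrs_le (hdeg k hk.le))))
          (hs k hk))
        (fun v w hvw => ((hr.consecutive_level hσ le_rfl) v w hvw).1)
        (by have := hr.card_le; nlinarith)
      refine ⟨fun t ht => Protocol.withinMemory_ofRoles _ _ _ _ _ (hmem t ht), ?_⟩
      intro i hi
      obtain ⟨x, rfl⟩ : ∃ x : Fin n, finSumFinEquiv (.inl x) = i :=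
        ⟨⟨0, hn⟩, Fin.ext (by simp [hi])⟩
      have hx : x.val = 0 := by simpa using hi
      refine (Protocol.result_ofRoles _ _ _ _ _ G p (s, r) _ _).trans ?_
      rw [Equiv.symm_apply_apply, Bool.eq_iff_iff, hb]
      refine (hverdict x hx).trans ?_
      constructor
      · intro h
        exact hσ.reachable_of_meetsCycles (hr.meetsCycles le_rfl) fun u hu v hv =>
          (hr.reachable_level_iff hu hv).1 (h u hu v hv)
      · exact fun h u hu v hv => (hr.reachable_level_iff hu hv).2 (h u v)
  intro G p hp
  constructor
  · intro h
    obtain ⟨σ, hσ⟩ := h.orients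
    exact main G p hp σ hσ true (by simpa using h.reachable)
  · intro h
    obtain ⟨σ, hσ⟩ := h.orients
    exact main G p hp σ hσ false (by simpa using h.exists_not_reachable)

end Reduction

/-! ### The choice of parameters -/

section Parameters

/-- The factor by which a phase on `N` nodes reduces the number of nodes. -/
def shrinkFactor (N : ℕ) : ℕ := Nat.log 2 N + 1

instance (N : ℕ) : NeZero (shrinkFactor N) := ⟨Nat.succ_ne_zero _⟩

/-- The diameter of the forests on `N` nodes to which the protocol for connected components is
applied. -/
def forestDiam (N : ℕ) : ℕ := 4 * (4 * shrinkFactor N * shrinkFactor N)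

/-- The number of nodes of the padded graphs. -/
def paddedSize (n : ℕ) : ℕ := n * (16 * shrinkFactor n)

/-- The number of phases; few enough for windows of all phases to fit into a cycle. -/
def phases (n : ℕ) : ℕ :=
  Nat.log (shrinkFactor (paddedSize n)) (n / (2 * (4 * shrinkFactor (paddedSize n))))

theorem lt_two_pow_shrinkFactor (N : ℕ) : N < 2 ^ shrinkFactor N :=
  Nat.lt_pow_succ_log_self (by norm_num) N

theorem log_le_shrinkFactor (N : ℕ) : Real.log N ≤ shrinkFactor N := by
  rcases Nat.eq_zero_or_pos N with rfl | hN
  · simp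
  · have h : Real.log N ≤ Real.log (2 ^ shrinkFactor N) :=
      Real.log_le_log (by exact_mod_cast hN) (by exact_mod_cast (lt_two_pow_shrinkFactor N).le)
    rw [Real.log_pow] at h
    have := Real.log_two_lt_d9
    nlinarith [(Nat.cast_nonneg (shrinkFactor N) : (0 : ℝ) ≤ _)]

theorem one_le_log {n : ℕ} (hn : 3 ≤ n) : 1 ≤ Real.log n := by
  rw [Real.le_log_iff_exp_le (by positivity)]
  have := Real.exp_one_lt_d9
  have : (3 : ℝ) ≤ n := by exact_mod_cast hn
  linarith

theorem shrinkFactor_le {N : ℕ} (hN : 3 ≤ N) : (shrinkFactor N : ℝ) ≤ 4 * Real.log N := by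
  have h1 := one_le_log hN
  have h2 : (2 : ℝ) ^ Nat.log 2 N ≤ N := by
    exact_mod_cast Nat.pow_log_le_self 2 (by omega)
  have h3 := Real.log_le_log (by positivity) h2
  rw [Real.log_pow] at h3
  have := Real.log_two_gt_d9
  rw [shrinkFactor]
  push_cast
  nlinarith [(Nat.cast_nonneg (Nat.log 2 N) : (0 : ℝ) ≤ _)]

theorem le_paddedSize (n : ℕ) : n ≤ paddedSize n :=
  Nat.le_mul_of_pos_right n (by unfold shrinkFactor; omega)

theorem tendsto_log_natCast : Tendsto (fun n : ℕ => Real.log n) atTop atTop :=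
  Real.tendsto_log_atTop.comp tendsto_natCast_atTop_atTop

theorem tendsto_paddedSize : Tendsto paddedSize atTop atTop :=
  tendsto_atTop_mono le_paddedSize tendsto_id

theorem tendsto_shrinkFactor : Tendsto (fun n => (shrinkFactor n : ℝ)) atTop atTop :=
  tendsto_atTop_mono log_le_shrinkFactor tendsto_log_natCast

/-- Powers of the logarithm are eventually smaller than any power of `n`. -/
theorem eventually_log_pow_le (C : ℝ) (j : ℕ) {ε : ℝ} (hε : 0 < ε) :
    ∀ᶠ n : ℕ in atTop, C * Real.log n ^ j ≤ (n : ℝ) ^ ε := by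
  have h := (isLittleO_log_rpow_rpow_atTop (j : ℝ) hε).comp_tendsto
    (tendsto_natCast_atTop_atTop (R := ℝ))
  have h' := h.bound (c := (|C| + 1)⁻¹) (by positivity)
  filter_upwards [h', eventually_ge_atTop 3] with n hn hn3
  have hlog : 0 ≤ Real.log n ^ j := pow_nonneg (zero_le_one.trans (one_le_log hn3)) _
  simp only [Function.comp_apply, Real.rpow_natCast, Real.norm_eq_abs, abs_of_nonneg hlog,
    abs_of_nonneg (Real.rpow_nonneg (Nat.cast_nonneg n) ε)] at hn
  rw [inv_mul_eq_div, le_div_iff₀ (by positivity)] at hn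
  nlinarith [le_abs_self C]

theorem eventually_paddedSize_le_sq : ∀ᶠ n : ℕ in atTop, paddedSize n ≤ n ^ 2 := by
  filter_upwards [eventually_log_pow_le 64 1 one_pos, eventually_ge_atTop 3] with n hn hn3
  rw [Real.rpow_one, pow_one] at hn
  have := shrinkFactor_le hn3
  have h : 16 * shrinkFactor n ≤ n := by
    have : (16 * shrinkFactor n : ℝ) ≤ n := by linarith
    exact_mod_cast this
  rw [paddedSize, sq]
  exact Nat.mul_le_mul_left n h

theorem eventually_shrinkFactor_paddedSize_le :
    ∀ᶠ n : ℕ in atTop, (shrinkFactor (paddedSize n) : ℝ) ≤ 8 * Real.log n := by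
  filter_upwards [eventually_paddedSize_le_sq, eventually_ge_atTop 3] with n hn hn3
  have h1 := shrinkFactor_le (hn3.trans (le_paddedSize n))
  have h2 : Real.log (paddedSize n) ≤ Real.log ((n : ℝ) ^ 2) :=
    Real.log_le_log (by exact_mod_cast (by have := le_paddedSize n; omega : 0 < paddedSize n))
      (by exact_mod_cast hn)
  rw [Real.log_pow] at h2
  push_cast at h2
  linarith

/-- Polynomials in the logarithm are within the local memory. -/
theorem eventually_poly_shrinkFactor_le (C : ℝ) (j : ℕ) {ε : ℝ} (hε : 0 < ε) :
    ∀ᶠ n : ℕ in atTop, C * (shrinkFactor (paddedSize n) : ℝ) ^ j ≤ (n : ℝ) ^ ε := by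
  filter_upwards [eventually_log_pow_le (|C| * 8 ^ j) j hε,
    eventually_shrinkFactor_paddedSize_le] with n hn hle
  refine le_trans ?_ hn
  calc C * (shrinkFactor (paddedSize n) : ℝ) ^ j ≤ |C| * (8 * Real.log n) ^ j := by
        gcongr
        exact le_abs_self C
    _ = _ := by rw [mul_pow]; ring

theorem eventually_localMemory_le {δ δ' : ℝ} (hδ : 0 < δ) (hδ1 : δ < 1) (h : δ < δ') :
    ∀ᶠ n : ℕ in atTop, localMemory δ (paddedSize n) ≤ localMemory δ' n := by
  filter_upwards [eventually_log_pow_le 64 1 (sub_pos.2 h), eventually_ge_atTop 3] with n hn hn3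
  apply Nat.floor_le_floor
  have hlog := one_le_log hn3
  have hn0 : (0 : ℝ) < n := by positivity
  rw [pow_one] at hn
  have hle : (paddedSize n : ℝ) ≤ n * (64 * Real.log n) := by
    rw [paddedSize]
    push_cast
    have := shrinkFactor_le hn3
    exact mul_le_mul_of_nonneg_left (by linarith) hn0.le
  calc (paddedSize n : ℝ) ^ δ ≤ (n * (64 * Real.log n)) ^ δ := by gcongr
    _ = (n : ℝ) ^ δ * (64 * Real.log n) ^ δ := Real.mul_rpow hn0.le (by positivity)
    _ ≤ (n : ℝ) ^ δ * (64 * Real.log n) := by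
        gcongr
        exact (Real.rpow_le_rpow_of_exponent_le (by linarith) hδ1.le).trans_eq (Real.rpow_one _)
    _ ≤ (n : ℝ) ^ δ * (n : ℝ) ^ (δ' - δ) := by gcongr
    _ = (n : ℝ) ^ δ' := by rw [← Real.rpow_add hn0]; ring_nf

theorem admissibleDiameter_forestDiam : AdmissibleDiameter forestDiam := by
  constructor
  · refine IsBigO.of_bound 1 ?_
    filter_upwards [eventually_ge_atTop 3] with n hn
    have h1 := one_le_log hn
    have h2 := log_le_shrinkFactor n
    rw [Real.norm_of_nonneg (by linarith), Real.norm_of_nonneg (by positivity), one_mul, forestDiam]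
    push_cast
    nlinarith
  · have h1 : (fun n : ℕ => Real.log (Real.log n)) =o[atTop] fun n : ℕ => Real.log n :=
      Real.isLittleO_log_id_atTop.comp_tendsto tendsto_log_natCast
    have h2 : (fun _ : ℕ => Real.log 256) =o[atTop] fun n : ℕ => Real.log n :=
      isLittleO_const_left.2 (.inr (tendsto_norm_atTop_atTop.comp tendsto_log_natCast))
    refine IsBigO.trans_isLittleO (IsBigO.of_bound 1 ?_) (h2.add (h1.const_mul_left 2))
    filter_upwards [eventually_ge_atTop 3] with n hn
    have h1 := one_le_log hn
    have h3 := shrinkFactor_le hn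
    have h5 : (1 : ℝ) ≤ shrinkFactor n := by exact_mod_cast NeZero.one_le
    have h4 : (forestDiam n : ℝ) ≤ 256 * Real.log n ^ 2 := by
      rw [forestDiam]
      push_cast
      nlinarith
    have h6 : (1 : ℝ) ≤ forestDiam n := by
      rw [forestDiam]
      push_cast
      nlinarith
    have h7 := Real.log_le_log (by linarith) h4
    rw [Real.log_mul (by norm_num) (by positivity), Real.log_pow] at h7
    push_cast at h7
    rw [Real.norm_of_nonneg (Real.log_nonneg h6), one_mul]
    exact h7.trans (le_abs_self _)

theorem shrinkFactor_pow_phases_le {n : ℕ} (hn : 2 * (4 * shrinkFactor (paddedSize n)) ≤ n) :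
    4 * shrinkFactor (paddedSize n) * shrinkFactor (paddedSize n) ^ phases n ≤ n / 2 := by
  set B := shrinkFactor (paddedSize n)
  have hB : 0 < B := Nat.pos_of_ne_zero (NeZero.ne _)
  have h1 : B ^ phases n ≤ n / (2 * (4 * B)) :=
    Nat.pow_log_le_self B (Nat.div_pos hn (by omega)).ne'
  refine (Nat.mul_le_mul_left _ h1).trans ?_
  rw [← Nat.div_div_eq_div_mul]
  exact Nat.mul_div_le _ _

theorem le_shrinkFactor_pow_phases {n : ℕ} (hB : 1 < shrinkFactor (paddedSize n)) :
    n ≤ 2 * (4 * shrinkFactor (paddedSize n) * shrinkFactor (paddedSize n)) *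
      shrinkFactor (paddedSize n) ^ phases n := by
  set B := shrinkFactor (paddedSize n)
  have h1 : n / (2 * (4 * B)) < B ^ (phases n + 1) := Nat.lt_pow_succ_log_self hB _
  rw [Nat.div_lt_iff_lt_mul (by omega)] at h1
  calc n ≤ B ^ (phases n + 1) * (2 * (4 * B)) := h1.le
    _ = _ := by ring

theorem phases_mul_log_le {n : ℕ} (hn : 2 * (4 * shrinkFactor (paddedSize n)) ≤ n) :
    phases n * Real.log (shrinkFactor (paddedSize n)) ≤ Real.log n := by
  have hB : 0 < shrinkFactor (paddedSize n) := Nat.pos_of_ne_zero (NeZero.ne _)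
  have h1 : shrinkFactor (paddedSize n) ^ phases n ≤ n := by
    have := shrinkFactor_pow_phases_le hn
    have h2 := Nat.le_mul_of_pos_left (shrinkFactor (paddedSize n) ^ phases n)
      (by omega : 0 < 4 * shrinkFactor (paddedSize n))
    omega
  rw [← Real.log_pow]
  exact Real.log_le_log (by positivity) (by exact_mod_cast h1)

/-- The number of rounds is `o(log n)`: in each of the at most `log n / log B` phases it is
`o(log B)`. -/
theorem isLittleO_rounds {T : ℕ → ℕ → ℕ} (hT : IsLittleOLogDiam T) :
    (fun n : ℕ => ((phases n * (T (paddedSize n) (forestDiam (paddedSize n)) + 5) + 2 : ℕ) : ℝ))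
      =o[atTop] (fun n : ℕ => Real.log n) := by
  rw [isLittleO_iff]
  intro ε hε
  have h1 := tendsto_paddedSize.eventually ((hT _ admissibleDiameter_forestDiam).bound
    (c := ε / 12) (by positivity))
  have hlogB := (Real.tendsto_log_atTop.comp
    (tendsto_shrinkFactor.comp tendsto_paddedSize)).eventually_ge_atTop (15 / ε)
  have hB4 := (tendsto_shrinkFactor.comp tendsto_paddedSize).eventually_ge_atTop 4
  filter_upwards [h1, hlogB, hB4, tendsto_log_natCast.eventually_ge_atTop (6 / ε),
    eventually_poly_shrinkFactor_le 8 1 one_pos] with n h1 hlogB hB4 hlog hle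
  simp only [Function.comp_apply] at hlogB hB4
  set B := shrinkFactor (paddedSize n) with hBdef
  have hlogn : 0 ≤ Real.log n := le_trans (by positivity) hlog
  have hlogB0 : 0 ≤ Real.log B := le_trans (by positivity) hlogB
  have h2 : 2 * (4 * B) ≤ n := by
    rw [pow_one, Real.rpow_one] at hle
    have : ((2 * (4 * B) : ℕ) : ℝ) ≤ n := by push_cast; linarith
    exact_mod_cast this
  have hph := phases_mul_log_le h2
  have hD : Real.log (forestDiam (paddedSize n)) ≤ 4 * Real.log B := by
    have : (forestDiam (paddedSize n) : ℝ) ≤ (B : ℝ) ^ 4 := by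
      rw [forestDiam, ← hBdef]
      push_cast
      have hB2 : (16 : ℝ) ≤ B ^ 2 := by nlinarith
      calc (4 * (4 * B * B) : ℝ) = 16 * B ^ 2 := by ring
        _ ≤ B ^ 2 * B ^ 2 := by gcongr
        _ = B ^ 4 := by ring
    have h3 := Real.log_le_log (by rw [forestDiam, ← hBdef]; push_cast; nlinarith) this
    rwa [Real.log_pow] at h3
  have hD0 : 0 ≤ Real.log (forestDiam (paddedSize n)) := Real.log_natCast_nonneg _
  rw [Real.norm_of_nonneg (Nat.cast_nonneg _), Real.norm_of_nonneg hD0] at h1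
  rw [Real.norm_of_nonneg (Nat.cast_nonneg _), Real.norm_of_nonneg hlogn]
  have h4 : (T (paddedSize n) (forestDiam (paddedSize n)) : ℝ) ≤ ε / 3 * Real.log B := by
    refine h1.trans ?_
    calc ε / 12 * Real.log (forestDiam (paddedSize n)) ≤ ε / 12 * (4 * Real.log B) := by gcongr
      _ = _ := by ring
  have h5 : (5 : ℝ) ≤ ε / 3 * Real.log B := by
    calc (5 : ℝ) = ε / 3 * (15 / ε) := by field_simp; norm_num
      _ ≤ _ := by gcongr
  have h6 : (2 : ℝ) ≤ ε / 3 * Real.log n := by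
    calc (2 : ℝ) = ε / 3 * (6 / ε) := by field_simp; norm_num
      _ ≤ _ := by gcongr
  push_cast
  calc (phases n * (T (paddedSize n) (forestDiam (paddedSize n)) + 5) + 2 : ℝ)
      ≤ phases n * (ε / 3 * Real.log B + ε / 3 * Real.log B) + ε / 3 * Real.log n := by gcongr
    _ = 2 * (ε / 3) * (phases n * Real.log B) + ε / 3 * Real.log n := by ring
    _ ≤ 2 * (ε / 3) * Real.log n + ε / 3 * Real.log n := by gcongr
    _ = ε * Real.log n := by ring

theorem failure_le {n : ℕ} (hn : 8 ≤ n) (h2 : 2 * (4 * shrinkFactor (paddedSize n)) ≤ n) :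
    (phases n : ℝ) * (1 / paddedSize n) +
      (2 * phases n * n + 1) * Real.exp (-(4 * shrinkFactor (paddedSize n) : ℕ)) ≤ 1 / n := by
  set B := shrinkFactor (paddedSize n) with hBdef
  have hn0 : (0 : ℝ) < n := by positivity
  have hn8 : (8 : ℝ) ≤ n := by exact_mod_cast hn
  have hBn : n < 2 ^ B := (le_paddedSize n).trans_lt (lt_two_pow_shrinkFactor _)
  have hB2 : 2 ≤ B := by
    by_contra hlt
    have : 2 ^ B ≤ 2 ^ 1 := Nat.pow_le_pow_right (by norm_num) (by omega)
    omega
  have hpow : 2 ^ phases n ≤ n := by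
    have h1 := shrinkFactor_pow_phases_le h2
    have h3 := Nat.pow_le_pow_left hB2 (phases n)
    have h4 := Nat.le_mul_of_pos_left (B ^ phases n) (by omega : 0 < 4 * B)
    rw [← hBdef] at h1
    omega
  have hK : phases n ≤ shrinkFactor n := by
    have : phases n ≤ Nat.log 2 n := Nat.le_log_of_pow_le (by norm_num) hpow
    exact this.trans (Nat.le_succ _)
  have hKn : (phases n : ℝ) ≤ n := by
    exact_mod_cast (Nat.lt_two_pow_self.le.trans hpow : phases n ≤ n)
  have h3 : (phases n : ℝ) * (1 / paddedSize n) ≤ 1 / (16 * n) := by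
    rw [mul_one_div, div_le_div_iff₀ (by
      exact_mod_cast (by have := le_paddedSize n; omega : 0 < paddedSize n)) (by positivity),
      paddedSize]
    have : (phases n : ℝ) ≤ shrinkFactor n := by exact_mod_cast hK
    push_cast
    nlinarith
  have hexp : Real.exp (-(4 * B : ℕ)) ≤ 1 / (n : ℝ) ^ 4 := by
    rw [Real.exp_neg, ← one_div]
    refine one_div_le_one_div_of_le (by positivity) ?_
    have h4 : (n : ℝ) ≤ Real.exp B := by
      have h5 : (n : ℝ) ≤ 2 ^ B := by exact_mod_cast hBn.le
      refine h5.trans ?_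
      rw [← Real.exp_one_pow]
      gcongr
      have := Real.exp_one_gt_d9
      linarith
    calc (n : ℝ) ^ 4 ≤ Real.exp B ^ 4 := by gcongr
      _ = _ := by rw [← Real.exp_nat_mul]; push_cast; rfl
  have h6 : (2 * phases n * n + 1) * Real.exp (-(4 * B : ℕ)) ≤ 1 / (2 * n) := by
    calc (2 * phases n * n + 1) * Real.exp (-(4 * B : ℕ))
        ≤ (2 * n * n + 1) * (1 / (n : ℝ) ^ 4) := by gcongr
      _ ≤ 1 / (2 * n) := by
        rw [mul_one_div, div_le_div_iff₀ (by positivity) (by positivity)]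
        have h7 : 8 * (n : ℝ) ^ 3 ≤ n * (n : ℝ) ^ 3 := by gcongr
        have h8 : (n : ℝ) ≤ (n : ℝ) ^ 3 := le_self_pow₀ (by linarith) (by norm_num)
        linarith [show (n : ℝ) ^ 4 = n * (n : ℝ) ^ 3 by ring,
          show (2 * n * n + 1) * (2 * n) = 4 * (n : ℝ) ^ 3 + 2 * n by ring]
  calc _ ≤ 1 / (16 * n : ℝ) + 1 / (2 * n) := add_le_add h3 h6
    _ ≤ 1 / n := by
      rw [div_add_div _ _ (by positivity) (by positivity), div_le_div_iff₀ (by positivity) hn0]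
      nlinarith

theorem card_word_le (n W : ℕ) : Fintype.card (Word n W) ≤ n * n + n + W := by
  have h : Fintype.card (Sym2 (Fin n)) ≤ n * n := by
    have := Fintype.card_le_of_surjective (Quot.mk (Sym2.Rel (Fin n))) Quot.mk_surjective
    simpa using this
  rw [Fintype.card_sum, Fintype.card_sum, Fintype.card_fin, Fintype.card_fin]
  omega

end Parameters

end MPC

theorem mainTheorem7 (hconj : MPC.OneVsTwoCyclesConjecture) :
    ∀ δ : ℝ, 0 < δ → δ < 1 →
      ¬ ∃ (A : ∀ n _D : ℕ, MPC.Protocol n (Fin n → Fin n)) (c : ℕ) (T : ℕ → ℕ → ℕ),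
        MPC.IsLittleOLogDiam T ∧
        ∀ᶠ n : ℕ in atTop, ∀ D : ℕ,
          (A n D).LowSpace δ c ∧
            (A n D).SolvesCCOnForests D (MPC.localMemory δ n) (T n D) := by
  classical
  rintro δ hδ hδ1 ⟨A, c, T, hT, hA⟩
  -- a larger exponent leaves room for the padding
  have hδ' : δ < (1 + δ) / 2 := by linarith
  have hδ'0 : 0 < (1 + δ) / 2 := by linarith
  refine hconj ((1 + δ) / 2) hδ'0 (by linarith) ?_
  let R : ℕ → ℕ := fun n => MPC.phases n *
    (T (MPC.paddedSize n) (MPC.forestDiam (MPC.paddedSize n)) + 5) + 2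
  have key : ∀ᶠ n : ℕ in atTop, ∃ P : MPC.Protocol n Bool, P.LowSpace ((1 + δ) / 2) (2 * c + 3) ∧
      P.SolvesOneVsTwoCycles (MPC.localMemory ((1 + δ) / 2) n) (R n) := by
    have hS10 : ∀ᶠ N : ℕ in atTop, 10 ≤ MPC.localMemory δ N :=
      (tendsto_nat_floor_atTop.comp
        ((tendsto_rpow_atTop hδ).comp tendsto_natCast_atTop_atTop)).eventually_ge_atTop 10
    filter_upwards [MPC.tendsto_paddedSize.eventually hA, MPC.tendsto_paddedSize.eventually hS10,
      MPC.eventually_localMemory_le hδ hδ1 hδ', MPC.eventually_poly_shrinkFactor_le 1156 4 hδ'0,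
      MPC.eventually_poly_shrinkFactor_le 17 2 one_pos, MPC.eventually_paddedSize_le_sq,
      eventually_ge_atTop 8] with n hA hS10 hSS hS' hBn hN2 hn8
    obtain ⟨⟨hM, hW, hMS⟩, hsolve⟩ := hA (MPC.forestDiam (MPC.paddedSize n))
    have hle := MPC.le_paddedSize n
    have hMpos : 0 < (A (MPC.paddedSize n) (MPC.forestDiam (MPC.paddedSize n))).machines := by
      by_contra h0
      rw [Nat.eq_zero_of_not_pos h0] at hMS
      omega
    have hB1 : 1 < MPC.shrinkFactor (MPC.paddedSize n) := by
      rw [MPC.shrinkFactor]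
      have := Nat.log_pos (b := 2) (by norm_num) (by omega : 2 ≤ MPC.paddedSize n)
      omega
    have hDn : MPC.forestDiam (MPC.paddedSize n) + 1 ≤ n := by
      have h1 : (1 : ℝ) ≤ MPC.shrinkFactor (MPC.paddedSize n) := by exact_mod_cast hB1.le
      have : ((MPC.forestDiam (MPC.paddedSize n) + 1 : ℕ) : ℝ) ≤ n := by
        rw [Real.rpow_one] at hBn
        rw [MPC.forestDiam]
        push_cast
        nlinarith
      exact_mod_cast this
    have h8 : 2 * (4 * MPC.shrinkFactor (MPC.paddedSize n)) ≤ n := by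
      rw [MPC.forestDiam] at hDn
      nlinarith
    have hS'' : 4 * ((MPC.forestDiam (MPC.paddedSize n) + 1) *
        (MPC.forestDiam (MPC.paddedSize n) + 1)) ≤ MPC.localMemory ((1 + δ) / 2) n := by
      apply Nat.le_floor
      refine le_trans ?_ hS'
      have h1 : (1 : ℝ) ≤ MPC.shrinkFactor (MPC.paddedSize n) := by exact_mod_cast hB1.le
      have h2 : (MPC.forestDiam (MPC.paddedSize n) + 1 : ℝ) ≤
          17 * (MPC.shrinkFactor (MPC.paddedSize n) : ℝ) ^ 2 := by
        rw [MPC.forestDiam]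
        push_cast
        nlinarith
      push_cast
      calc (4 * ((MPC.forestDiam (MPC.paddedSize n) + 1) *
            (MPC.forestDiam (MPC.paddedSize n) + 1)) : ℝ)
          ≤ 4 * ((17 * (MPC.shrinkFactor (MPC.paddedSize n) : ℝ) ^ 2) *
            (17 * (MPC.shrinkFactor (MPC.paddedSize n) : ℝ) ^ 2)) := by gcongr
        _ = _ := by ring
    have h16 : 16 * n ≤ MPC.paddedSize n := by
      rw [MPC.paddedSize, mul_comm]
      exact Nat.mul_le_mul_left n (by unfold MPC.shrinkFactor; omega)
    have hpow : MPC.paddedSize n ^ c ≤ n ^ (2 * c) :=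
      (Nat.pow_le_pow_left hN2 c).trans_eq (by rw [← pow_mul])
    have hc0 : 1 ≤ n ^ (2 * c) := Nat.one_le_pow _ _ (by omega)
    refine ⟨MPC.cycleProtocol hle _ (MPC.dealt _ hMpos) (MPC.forestDiam (MPC.paddedSize n))
      (T (MPC.paddedSize n) (MPC.forestDiam (MPC.paddedSize n)))
      (MPC.shrinkFactor (MPC.paddedSize n)) (MPC.phases n), ⟨?_, ?_, ?_⟩, ?_⟩
    · change n + _ ≤ _
      rw [pow_add]
      nlinarith [Nat.pow_le_pow_right (by omega : 0 < n) (by norm_num : 1 ≤ 3)]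
    · change Fintype.card (MPC.Word n _) ≤ _
      refine (MPC.card_word_le _ _).trans ?_
      rw [pow_add]
      have h3 : n * n + n + 1 ≤ n ^ 3 := by
        rw [show n ^ 3 = n * n * n by ring]
        nlinarith
      calc _ ≤ 1 * (n * n + n) + n ^ (2 * c) := by omega
        _ ≤ n ^ (2 * c) * (n * n + n) + n ^ (2 * c) := by gcongr
        _ = n ^ (2 * c) * (n * n + n + 1) := by ring
        _ ≤ _ := Nat.mul_le_mul_left _ h3
    · change 3 * n ≤ (n + _) * _
      nlinarith
    · exact MPC.cycleProtocol_solves hle hMpos (by omega) (by omega) hsolve hMS hS10 hSS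
        rfl hS'' (MPC.le_shrinkFactor_pow_phases hB1) (MPC.shrinkFactor_pow_phases_le h8)
        (MPC.failure_le hn8 h8)
  have hex : ∀ n, ∃ P : MPC.Protocol n Bool,
      (∃ P : MPC.Protocol n Bool, P.LowSpace ((1 + δ) / 2) (2 * c + 3) ∧
        P.SolvesOneVsTwoCycles (MPC.localMemory ((1 + δ) / 2) n) (R n)) →
      P.LowSpace ((1 + δ) / 2) (2 * c + 3) ∧
        P.SolvesOneVsTwoCycles (MPC.localMemory ((1 + δ) / 2) n) (R n) := by
    intro n
    by_cases h : ∃ P : MPC.Protocol n Bool, P.LowSpace ((1 + δ) / 2) (2 * c + 3) ∧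
        P.SolvesOneVsTwoCycles (MPC.localMemory ((1 + δ) / 2) n) (R n)
    · exact ⟨h.choose, fun _ => h.choose_spec⟩
    · exact ⟨⟨0, 0, Unit, fun _ _ _ _ => [], fun _ _ _ _ _ => ([], fun _ => []),
        fun _ _ _ _ => true⟩, fun h' => absurd h' h⟩
  choose P hP using hex
  exact ⟨P, 2 * c + 3, R, MPC.isLittleO_rounds hT, key.mono fun n hn => hP n hn⟩
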